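/- Let $\mathbb{A}$ be a commutative associative unital algebra of finite dimension $n\ge 1$ over $\mathbb{C}$, with basis $I_1,\dots,I_n$ and with its topology of a finite-dimensional complex vector space. Let $2\le k\le 2n$, let $e_1=1,e_2,\dots,e_k\in\mathbb{A}$ be linearly independent over $\mathbb{R}$, let $E_k=\{\sum_{j=1}^k x_je_j : x_j\in\mathbb{R}\}$, with the topology carried over from $\mathbb{R}^k$ by the coordinates $(x_1,\dots,x_k)$, and assume that $f(E_k)=\mathbb{C}$ for every unital algebra homomorphism $f:\mathbb{A}\to\mathbb{C}$. Let $\Omega\subset E_k$ be a domain (a nonempty connected open subset of $E_k$), and let $\Phi:\Omega\to\mathbb{A}$ be monogenic, that is, $\Phi$ is continuous and for every $\zeta\in\Omega$ there is $\Phi'(\zeta)\in\mathbb{A}$ such that $$\lim_{\varepsilon\to 0+}\frac{\Phi(\zeta+\varepsilon h)-\Phi(\zeta)}{\varepsilon}=h\,\Phi'(\zeta)\qquad\text{for all } h\in E_k .$$ Then for every closed rectifiable Jordan curve $\gamma$ in $\Omega$ that is homotopic to a point in $\Omega$, $$\int_\gamma \Phi(\zeta)\,d\zeta=0 .$$ Here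 $d\zeta=e_1dx_1+\dots+e_kdx_k$, and if $\Phi=\sum_{r=1}^n (U_r+iV_r)I_r$ with $U_r,V_r$ real-valued, the integral is defined through Riemann–Stieltjes integrals by $$\int_\gamma\Phi(\zeta)\,d\zeta=\sum_{j=1}^k e_j\sum_{r=1}^n I_r\int_{\gamma}U_r\,dx_j+i\sum_{j=1}^k e_j\sum_{r=1}^n I_r\int_{\gamma}V_r\,dx_j .$$ -/

import Mathlib

open Filter Topology Set

noncomputable section

namespace Monogenic

/-- The point `∑ⱼ xⱼ eⱼ` with real coordinates `x` in the system `e`. -/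
def point {A : Type*} [CommRing A] [Algebra ℂ A] {k : ℕ} (e : Fin k → A)
    (x : EuclideanSpace ℝ (Fin k)) : A :=
  ∑ j, x j • e j

/-- The space `E_k`, the real linear span of `e₁, …, e_k`. -/
def realSpan {A : Type*} [CommRing A] [Algebra ℂ A] {k : ℕ} (e : Fin k → A) : Submodule ℝ A :=
  Submodule.span ℝ (range e)

/-- The subset `Q_ℝ` of `ℝ^k` that corresponds to a subset `Q` of `E_k`. -/
def realSet {A : Type*} [CommRing A] [Algebra ℂ A] {k : ℕ} (e : Fin k → A) (Q : Set A) :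
    Set (EuclideanSpace ℝ (Fin k)) :=
  {x | point e x ∈ Q}

/-- `Ω` is a domain in `E_k`: a subset of `E_k` which is open and connected (and nonempty) in the
coordinates `x ∈ ℝ^k`. -/
structure IsDomainIn {A : Type*} [CommRing A] [Algebra ℂ A] {k : ℕ} (e : Fin k → A)
    (Ω : Set A) : Prop where
  subset : Ω ⊆ realSpan e
  isOpen : IsOpen (realSet e Ω)
  isConnected : IsConnected (realSet e Ω)

/-- `Φ` is monogenic in `Ω ⊆ E_k`: it is continuous in `Ω` and at every `ζ ∈ Ω` it has a Gateaux
derivative, an element `d` of the algebra such that the one-sided directional derivative of `Φ`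
at `ζ` along every `h ∈ E_k` equals `h * d`. Only the values of `Φ` in `Ω` matter, as `Ω` is open
in `E_k`. -/
structure IsMonogenicOn {A : Type*} [CommRing A] [Algebra ℂ A] [TopologicalSpace A] {k : ℕ}
    (e : Fin k → A) (Φ : A → A) (Ω : Set A) : Prop where
  continuousOn : ContinuousOn (fun x => Φ (point e x)) (realSet e Ω)
  gateaux : ∀ ζ ∈ Ω, ∃ d : A, ∀ h ∈ realSpan e,
    Tendsto (fun ε : ℝ => ε⁻¹ • (Φ (ζ + ε • h) - Φ ζ)) (𝓝[>] 0) (𝓝 (h * d))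

/-- The Riemann-Stieltjes integral `∫₀¹ f dg` exists and equals `J`: the Riemann-Stieltjes sums
over the tagged partitions `0 = t₀ ≤ t₁ ≤ ⋯ ≤ t_N = 1` of the unit interval, with tags
`ξᵢ ∈ [tᵢ, tᵢ₊₁]`, tend to `J` as the mesh tends to zero. -/
def HasStieltjesIntegral (f g : ℝ → ℝ) (J : ℝ) : Prop :=
  ∀ ε : ℝ, 0 < ε → ∃ δ : ℝ, 0 < δ ∧ ∀ (N : ℕ) (t ξ : ℕ → ℝ), t 0 = 0 → t N = 1 →
    (∀ i < N, ξ i ∈ Icc (t i) (t (i + 1)) ∧ t (i + 1) - t i < δ) →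
    |∑ i ∈ Finset.range N, f (ξ i) * (g (t (i + 1)) - g (t i)) - J| < ε

/-- The curvilinear integral `∫_γ Ψ(ζ) dζ`, `dζ = e₁ dx₁ + ⋯ + e_k dx_k`, along the curve
`γ = {∑ⱼ xⱼ(t) eⱼ : 0 ≤ t ≤ 1}` exists and equals `z`. With `Ψ = ∑ᵣ Uᵣ Iᵣ + i ∑ᵣ Vᵣ Iᵣ`,
`Uᵣ` and `Vᵣ` real, the integral is
`∑ⱼ eⱼ ∑ᵣ Iᵣ ∫ Uᵣ dxⱼ + i ∑ⱼ eⱼ ∑ᵣ Iᵣ ∫ Vᵣ dxⱼ`. -/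
def HasCurveIntegral {A : Type*} [CommRing A] [Algebra ℂ A] {n k : ℕ}
    (I : Module.Basis (Fin n) ℂ A) (e : Fin k → A) (Ψ : A → A)
    (x : ℝ → EuclideanSpace ℝ (Fin k)) (z : A) : Prop :=
  ∃ P Q : Fin k → Fin n → ℝ,
    (∀ j r, HasStieltjesIntegral (fun t => (I.repr (Ψ (point e (x t))) r).re)
      (fun t => x t j) (P j r)) ∧
    (∀ j r, HasStieltjesIntegral (fun t => (I.repr (Ψ (point e (x t))) r).im)
      (fun t => x t j) (Q j r)) ∧
    z = (∑ j, e j * ∑ r, P j r • I r) + Complex.I • (∑ j, e j * ∑ r, Q j r • I r)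

end Monogenic

end

/-!
Composing `Φ(ζ) dζ` with a real functional `ℓ` of the algebra gives a real 1-form on an open set of
`ℝ^k`. Its directional derivatives at `x` are `ℓ(h' h Φ'(ζ))`, symmetric in `h` and `h'` because the
algebra is commutative, so the form is closed, but only in the sense of Gateaux: it is neither
continuously nor Fréchet differentiable. Along the cone over a segment such a form pulls back to
`u ds + v dt` on a rectangle, with `∂v/∂s = ∂u/∂t` pointwise, and the integral of this form along
the boundary vanishes by the argument of Looman and Menchoff. Indeed, let `E` be the closed set of
points without a neighbourhood in which these integrals vanish. By Baire's theorem `u` and `v` are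
uniformly Lipschitz along the axes at the points of some nonempty open part of `E`; there Green's
formula holds up to an error controlled by the measure of the complement of `E` near `E`, which
can be made arbitrarily small, so the part was empty.

Hence the integral along every small triangle vanishes. Cutting a null homotopy of `γ` by a fine
grid then shows that the integrals along fine polygons inscribed in `γ` vanish, and, since `γ` is
rectifiable, these integrals approximate the Riemann–Stieltjes sums.
-/

noncomputable section

open MeasureTheory NNReal

namespace Monogenic

section FundamentalTheorem

theorem ae_uniqueDiffWithinAt (μ : Measure ℝ) [NullSingletonClass μ] (E : Set ℝ) :
    ∀ᵐ x ∂μ, x ∈ E → UniqueDiffWithinAt ℝ E x := by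
  have hisolated : {x ∈ E | 𝓝[E ∩ Ioi x] x = ⊥}.Countable :=
    countable_setOfPred_isolated_right_within
  filter_upwards [hisolated.ae_notMem μ] with x hx hxE
  rw [uniqueDiffWithinAt_iff_accPt, accPt_principal_iff_nhdsWithin]
  have : (𝓝[E ∩ Ioi x] x).NeBot := ⟨fun h0 => hx ⟨hxE, h0⟩⟩
  exact this.mono (nhdsWithin_mono x fun y hy => ⟨hy.1, ne_of_gt hy.2⟩)

variable {g : ℝ → ℝ} {a b : ℝ} {E : Set ℝ} {N : ℝ≥0}

theorem lipschitzOnWith_insert_insert (hEab : E ⊆ Icc a b) (hne : E.Nonempty)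
    (hN : ∀ x ∈ E, ∀ y ∈ Icc a b, dist (g y) (g x) ≤ N * dist y x) :
    LipschitzOnWith N g (insert a (insert b E)) := by
  obtain ⟨p, hp⟩ := hne
  have hab : a ≤ b := (hEab hp).1.trans (hEab hp).2
  have hends : dist (g a) (g b) ≤ N * dist a b := by
    calc dist (g a) (g b) ≤ dist (g a) (g p) + dist (g b) (g p) := dist_triangle_right ..
      _ ≤ N * dist a p + N * dist b p :=
        add_le_add (hN p hp a (left_mem_Icc.2 hab)) (hN p hp b (right_mem_Icc.2 hab))
      _ = N * dist a b := by
        rw [Real.dist_eq, Real.dist_eq, Real.dist_eq, abs_of_nonpos (sub_nonpos.2 (hEab hp).1),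
          abs_of_nonneg (sub_nonneg.2 (hEab hp).2), abs_of_nonpos (sub_nonpos.2 hab)]
        ring
  refine LipschitzOnWith.of_dist_le_mul ?_
  rintro x (rfl | rfl | hx) y (rfl | rfl | hy)
  · simp
  · exact hends
  · exact hN y hy x (left_mem_Icc.2 hab)
  · rwa [dist_comm, dist_comm x]
  · simp
  · exact hN y hy x (right_mem_Icc.2 hab)
  · rw [dist_comm, dist_comm x]; exact hN x hx y (left_mem_Icc.2 hab)
  · rw [dist_comm, dist_comm x]; exact hN x hx y (right_mem_Icc.2 hab)
  · rw [dist_comm, dist_comm x]; exact hN x hx y (hEab hy)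

theorem abs_sub_sub_setIntegral_deriv_le (hE : IsClosed E) (hEab : E ⊆ Icc a b)
    (hne : E.Nonempty) (hN : ∀ x ∈ E, ∀ y ∈ Icc a b, dist (g y) (g x) ≤ N * dist y x)
    (hg : ∀ x ∈ E, DifferentiableAt ℝ g x) :
    |g b - g a - ∫ x in E, deriv g x| ≤ N * volume.real (Icc a b \ E) := by
  have hab : a ≤ b := nonempty_Icc.1 (hne.mono hEab)
  -- `g` agrees on `E` and at the end points with a Lipschitz function `f`, for which the
  -- fundamental theorem of calculus holds; almost everywhere on `E` the derivatives agree.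
  obtain ⟨f, hf, hfg⟩ := (lipschitzOnWith_insert_insert hEab hne hN).extend_real
  have hfE : EqOn g f E := fun x hx => hfg (by simp [hx])
  have hftc : ∫ x in Icc a b, deriv f x = g b - g a := by
    rw [hfg (by simp : a ∈ insert a (insert b E)), hfg (by simp : b ∈ insert a (insert b E)),
      integral_Icc_eq_integral_Ioc, ← intervalIntegral.integral_of_le hab]
    exact (hf.lipschitzOnWith (s := uIcc a b)).absolutelyContinuousOnInterval.integral_deriv_eq_sub
  have hbound : ∀ x, ‖deriv f x‖ ≤ N := fun x => norm_deriv_le_of_lipschitz hf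
  have hint : IntegrableOn (deriv f) (Icc a b) :=
    Measure.integrableOn_of_bounded (by simp) (measurable_deriv f).aestronglyMeasurable
      (Eventually.of_forall hbound)
  have hderiv : ∫ x in E, deriv g x = ∫ x in E, deriv f x := by
    refine setIntegral_congr_ae hE.measurableSet ?_
    filter_upwards [hf.ae_differentiableAt_real, ae_uniqueDiffWithinAt volume E] with x h1 h2 hx
    exact (h2 hx).eq_deriv E (hg x hx).hasDerivAt.hasDerivWithinAt
      (h1.hasDerivAt.hasDerivWithinAt.congr hfE (hfE hx))
  rw [hderiv, ← hftc, ← setIntegral_sdiff hE.measurableSet hint hEab, ← Real.norm_eq_abs]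
  exact norm_setIntegral_le_of_norm_le_const
    ((measure_mono sdiff_subset).trans_lt measure_Icc_lt_top) fun x _ => hbound x

end FundamentalTheorem

section Slices

variable {F : Type*} [NormedAddCommGroup F] [NormedSpace ℝ F] {S : Set (ℝ × ℝ)} {f : ℝ × ℝ → F}
  {c d : ℝ}

theorem setIntegral_slice_eq_integral_indicator (hS : MeasurableSet S) (f : ℝ × ℝ → F) (t : ℝ) :
    ∫ s in {s | (s, t) ∈ S}, f (s, t) = ∫ s, S.indicator f (s, t) := by
  have hSt : MeasurableSet {s | (s, t) ∈ S} := hS.preimage (by fun_prop)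
  rw [← integral_indicator hSt]
  rfl

theorem intervalIntegrable_setIntegral_slice (hS : MeasurableSet S) (hf : IntegrableOn f S)
    (c d : ℝ) :
    IntervalIntegrable (fun t => ∫ s in {s | (s, t) ∈ S}, f (s, t)) volume c d := by
  simp only [setIntegral_slice_eq_integral_indicator hS]
  exact ((integrable_indicator_iff hS).2 hf).integral_prod_right.intervalIntegrable

theorem setIntegral_eq_intervalIntegral_slice (hcd : c ≤ d) (hS : MeasurableSet S)
    (hScd : ∀ z ∈ S, z.2 ∈ Icc c d) (hf : IntegrableOn f S) :
    ∫ z in S, f z = ∫ t in c..d, ∫ s in {s | (s, t) ∈ S}, f (s, t) := by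
  rw [← integral_indicator hS, Measure.volume_eq_prod,
    integral_prod_symm _ ((integrable_indicator_iff hS).2 hf), intervalIntegral.integral_of_le hcd,
    ← integral_Icc_eq_integral_Ioc]
  simp only [setIntegral_slice_eq_integral_indicator hS]
  refine (setIntegral_eq_integral_of_forall_compl_eq_zero fun t ht => ?_).symm
  have hSt : ∀ s, S.indicator f (s, t) = 0 := fun s =>
    indicator_of_notMem (fun h => ht (hScd _ h)) f
  simp only [hSt, integral_zero]

end Slices

/-- From the point `z`, the increments of `w` along the axes over steps of size at most `η` are
bounded by `N` times the step. This is the quantitative form of differentiability along the axes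
to which Baire's theorem is applied. -/
def AxisLipschitz (w : ℝ × ℝ → ℝ) (N : ℝ≥0) (η : ℝ) (z : ℝ × ℝ) : Prop :=
  ∀ h : ℝ, |h| ≤ η → |w (z.1 + h, z.2) - w z| ≤ N * |h| ∧ |w (z.1, z.2 + h) - w z| ≤ N * |h|

section AxisLipschitz

variable {w : ℝ × ℝ → ℝ} {N : ℝ≥0} {η : ℝ} {z : ℝ × ℝ}

theorem AxisLipschitz.swap (h : AxisLipschitz w N η z) :
    AxisLipschitz (w ∘ Prod.swap) N η z.swap := fun t ht => (h t ht).symm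

theorem AxisLipschitz.anti (h : AxisLipschitz w N η z) {η' : ℝ} (hη : η' ≤ η) :
    AxisLipschitz w N η' z := fun t ht => h t (ht.trans hη)

theorem AxisLipschitz.dist_fst_le (h : AxisLipschitz w N η z) {x : ℝ} (hx : dist x z.1 ≤ η) :
    dist (w (x, z.2)) (w z) ≤ N * dist x z.1 := by
  simpa [Real.dist_eq] using (h _ hx).1

theorem AxisLipschitz.dist_snd_le (h : AxisLipschitz w N η z) {y : ℝ} (hy : dist y z.2 ≤ η) :
    dist (w (z.1, y)) (w z) ≤ N * dist y z.2 := by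
  simpa [Real.dist_eq] using (h _ hy).2

theorem AxisLipschitz.norm_deriv_le (h : AxisLipschitz w N η z) (hη : 0 < η) :
    ‖deriv (fun s => w (s, z.2)) z.1‖ ≤ N := by
  refine norm_deriv_le_of_lip' N.2 ?_
  filter_upwards [Metric.closedBall_mem_nhds z.1 hη] with x hx
  exact h.dist_fst_le hx

theorem isClosed_setOf_axisLipschitz (hw : Continuous w) (N : ℝ≥0) (η : ℝ) :
    IsClosed {z | AxisLipschitz w N η z} := by
  simp only [AxisLipschitz, ofPred_forall, ofPred_and]
  refine isClosed_iInter fun h => isClosed_iInter fun _ => ?_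
  exact (isClosed_le (by fun_prop) continuous_const).inter
    (isClosed_le (by fun_prop) continuous_const)

theorem exists_abs_sub_le_of_differentiableAt {g : ℝ → ℝ} {x : ℝ} (hg : DifferentiableAt ℝ g x) :
    ∃ K : ℝ, ∃ η > 0, ∀ h : ℝ, |h| ≤ η → |g (x + h) - g x| ≤ K * |h| := by
  obtain ⟨K, hK⟩ := hg.isBigO_sub.bound
  obtain ⟨η, hη, hball⟩ := Metric.nhds_basis_closedBall.eventually_iff.1 hK
  exact ⟨K, η, hη, fun h hh => by simpa using @hball (x + h) (by simpa [Real.dist_eq] using hh)⟩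

theorem eventually_axisLipschitz (h₁ : DifferentiableAt ℝ (fun s => w (s, z.2)) z.1)
    (h₂ : DifferentiableAt ℝ (fun t => w (z.1, t)) z.2) :
    ∀ᶠ N : ℝ≥0 in atTop, AxisLipschitz w N (N : ℝ)⁻¹ z := by
  obtain ⟨K₁, η₁, hη₁, hK₁⟩ := exists_abs_sub_le_of_differentiableAt h₁
  obtain ⟨K₂, η₂, hη₂, hK₂⟩ := exists_abs_sub_le_of_differentiableAt h₂
  have hcoe : Tendsto ((↑) : ℝ≥0 → ℝ) atTop atTop := NNReal.tendsto_coe_atTop.2 tendsto_id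
  filter_upwards [hcoe.eventually_ge_atTop K₁, hcoe.eventually_ge_atTop K₂,
    hcoe.eventually_ge_atTop η₁⁻¹, hcoe.eventually_ge_atTop η₂⁻¹] with N hN₁ hN₂ hNη₁ hNη₂ h hh
  exact ⟨(hK₁ h (hh.trans (inv_le_of_inv_le₀ hη₁ hNη₁))).trans (by gcongr),
    (hK₂ h (hh.trans (inv_le_of_inv_le₀ hη₂ hNη₂))).trans (by gcongr)⟩

theorem AxisLipschitz.abs_sub_le {a b t₀ t₁ t δ : ℝ} (h₀ : AxisLipschitz w N η (a, t₀))
    (h₁ : AxisLipschitz w N η (b, t₁)) (hab : dist b a ≤ η) (hδ : δ ≤ η)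
    (ht₀ : dist t t₀ ≤ δ) (ht₁ : dist t t₁ ≤ δ) (ht₀₁ : dist t₀ t₁ ≤ δ) :
    |w (b, t) - w (a, t)| ≤ N * (dist b a + 3 * δ) := by
  have hstep : ∀ {x s s' : ℝ}, AxisLipschitz w N η (x, s) → dist s' s ≤ δ →
      dist (w (x, s')) (w (x, s)) ≤ N * δ := fun h hs =>
    (h.dist_snd_le (hs.trans hδ)).trans (by gcongr)
  calc dist (w (b, t)) (w (a, t))
      ≤ dist (w (b, t)) (w (b, t₁)) + dist (w (b, t₁)) (w (b, t₀)) + dist (w (b, t₀)) (w (a, t₀))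
        + dist (w (a, t₀)) (w (a, t)) :=
        (dist_triangle _ (w (a, t₀)) _).trans (by gcongr; exact dist_triangle4 ..)
    _ ≤ N * δ + N * δ + N * dist b a + N * δ := by
        gcongr
        · exact hstep h₁ ht₁
        · rw [dist_comm]; exact hstep h₁ ht₀₁
        · exact h₀.dist_fst_le hab
        · rw [dist_comm]; exact hstep h₀ ht₀
    _ = N * (dist b a + 3 * δ) := by ring

theorem measurable_deriv_fst (hw : Continuous w) :
    Measurable fun z : ℝ × ℝ => deriv (fun s => w (s, z.2)) z.1 :=
  (measurable_deriv_with_param (f := fun t s => w (s, t))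
    (hw.comp continuous_swap :)).comp measurable_swap

end AxisLipschitz

/-- `[a, b] × [c, d]` is the smallest rectangle containing `E`: it contains `E`, and `E` meets all
its sides. -/
structure IsBoundingRect (E : Set (ℝ × ℝ)) (a b c d : ℝ) : Prop where
  subset : E ⊆ Icc a b ×ˢ Icc c d
  left : ∃ t, (a, t) ∈ E
  right : ∃ t, (b, t) ∈ E
  bottom : ∃ s, (s, c) ∈ E
  top : ∃ s, (s, d) ∈ E

namespace IsBoundingRect

variable {E : Set (ℝ × ℝ)} {a b c d a' b' c' d' : ℝ}

theorem swap (h : IsBoundingRect E a b c d) : IsBoundingRect (Prod.swap ⁻¹' E) c d a b :=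
  ⟨fun _ hz => (h.subset hz).symm, h.bottom, h.top, h.left, h.right⟩

theorem le_left (h : IsBoundingRect E a' b' c' d') (hE : E ⊆ Icc a b ×ˢ Icc c d) : a ≤ a' :=
  h.left.elim fun _ ht => (hE ht).1.1

theorem right_le (h : IsBoundingRect E a' b' c' d') (hE : E ⊆ Icc a b ×ˢ Icc c d) : b' ≤ b :=
  h.right.elim fun _ ht => (hE ht).1.2

theorem le_bottom (h : IsBoundingRect E a' b' c' d') (hE : E ⊆ Icc a b ×ˢ Icc c d) : c ≤ c' :=
  h.bottom.elim fun _ hs => (hE hs).2.1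

theorem top_le (h : IsBoundingRect E a' b' c' d') (hE : E ⊆ Icc a b ×ˢ Icc c d) : d' ≤ d :=
  h.top.elim fun _ hs => (hE hs).2.2

theorem left_le_right (h : IsBoundingRect E a b c d) : a ≤ b :=
  h.left.elim fun _ ht => (h.subset ht).1.2

theorem bottom_le_top (h : IsBoundingRect E a b c d) : c ≤ d :=
  h.bottom.elim fun _ hs => (h.subset hs).2.2

end IsBoundingRect

theorem exists_isBoundingRect {E : Set (ℝ × ℝ)} (hE : IsCompact E) (hne : E.Nonempty) :
    ∃ a b c d, IsBoundingRect E a b c d := by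
  obtain ⟨l, hlE, hl⟩ := hE.exists_isMinOn hne continuous_fst.continuousOn
  obtain ⟨r, hrE, hr⟩ := hE.exists_isMaxOn hne continuous_fst.continuousOn
  obtain ⟨p, hpE, hp⟩ := hE.exists_isMinOn hne continuous_snd.continuousOn
  obtain ⟨q, hqE, hq⟩ := hE.exists_isMaxOn hne continuous_snd.continuousOn
  exact ⟨l.1, r.1, p.2, q.2, fun z hz => ⟨⟨hl hz, hr hz⟩, hp hz, hq hz⟩,
    ⟨l.2, hlE⟩, ⟨r.2, hrE⟩, ⟨p.1, hpE⟩, ⟨q.1, hqE⟩⟩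

section Increments

variable {w : ℝ × ℝ → ℝ} {a b c d a' b' c' d' η : ℝ} {E : Set (ℝ × ℝ)} {N κ : ℝ≥0}

theorem abs_sub_sub_setIntegral_slice_deriv_le (hE : IsClosed E)
    (hEQ : E ⊆ Icc a b ×ˢ Icc c d) (hER : IsBoundingRect E a' b' c' d')
    (hN : ∀ z ∈ E, AxisLipschitz w N η z)
    (hd : ∀ z ∈ E, DifferentiableAt ℝ (fun s => w (s, z.2)) z.1)
    (hη₁ : b - a ≤ η) (hη₂ : d - c ≤ η) (hκ : d - c ≤ κ * (b - a)) {t : ℝ} (ht : t ∈ Icc c d) :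
    |w (b', t) - w (a', t) - ∫ s in {s | (s, t) ∈ E}, deriv (fun s => w (s, t)) s| ≤
      N * (1 + 3 * κ) * volume.real {s | (s, t) ∈ (Icc a b ×ˢ Icc c d) \ E} := by
  have hle : a' ≤ b' := hER.left_le_right
  have hsub : Icc a' b' ⊆ Icc a b := Icc_subset_Icc (hER.le_left hEQ) (hER.right_le hEQ)
  have hlen : b' - a' ≤ b - a := sub_le_sub (hER.right_le hEQ) (hER.le_left hEQ)
  have hslice : {s | (s, t) ∈ (Icc a b ×ˢ Icc c d) \ E} = Icc a b \ {s | (s, t) ∈ E} := by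
    ext s; simp [ht.1, ht.2]
  rw [hslice]
  rcases eq_empty_or_nonempty {s | (s, t) ∈ E} with hempty | hne
  · obtain ⟨t₀, ht₀⟩ := hER.left
    obtain ⟨t₁, ht₁⟩ := hER.right
    have hbound := (hN _ ht₀).abs_sub_le (hN _ ht₁)
      ((Real.dist_le_of_mem_Icc (right_mem_Icc.2 hle) (left_mem_Icc.2 hle)).trans
        (hlen.trans hη₁)) hη₂
      (Real.dist_le_of_mem_Icc ht (hEQ ht₀).2) (Real.dist_le_of_mem_Icc ht (hEQ ht₁).2)
      (Real.dist_le_of_mem_Icc (hEQ ht₀).2 (hEQ ht₁).2)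
    rw [Real.dist_eq, abs_of_nonneg (sub_nonneg.2 hle)] at hbound
    rw [hempty, setIntegral_empty, sub_zero, sdiff_empty, Real.volume_real_Icc_of_le
      ((hER.le_left hEQ).trans (hle.trans (hER.right_le hEQ))), mul_assoc]
    exact hbound.trans (by gcongr; linarith)
  · have hbound := abs_sub_sub_setIntegral_deriv_le (g := fun s => w (s, t)) (N := N)
      (hE.preimage (by fun_prop : Continuous fun s : ℝ => (s, t)))
      (fun s hs => (hER.subset hs).1) hne
      (fun x hx y hy => (hN _ hx).dist_fst_le <|
        (Real.dist_le_of_mem_Icc hy (hER.subset hx).1).trans (hlen.trans hη₁))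
      (fun x hx => hd _ hx)
    calc _ ≤ N * volume.real (Icc a' b' \ {s | (s, t) ∈ E}) := hbound
      _ ≤ N * (1 + 3 * κ) * volume.real (Icc a b \ {s | (s, t) ∈ E}) := by
        refine mul_le_mul (le_mul_of_one_le_right N.2 (by linarith [κ.2])) ?_ (by positivity)
          (by positivity)
        exact measureReal_mono (sdiff_subset_sdiff_left hsub)
          (ne_top_of_le_ne_top measure_Icc_lt_top.ne (measure_mono sdiff_subset))

theorem isCompact_rect (a b c d : ℝ) : IsCompact (Icc a b ×ˢ Icc c d) :=
  isCompact_Icc.prod isCompact_Icc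

theorem AxisLipschitz.integrableOn_deriv (hw : Continuous w) (hE : IsCompact E) (hη : 0 < η)
    (hN : ∀ z ∈ E, AxisLipschitz w N η z) :
    IntegrableOn (fun z => deriv (fun s => w (s, z.2)) z.1) E :=
  Measure.integrableOn_of_bounded (M := N) hE.measure_lt_top.ne
    (measurable_deriv_fst hw).aestronglyMeasurable
    ((ae_restrict_iff' hE.measurableSet).2
      (Eventually.of_forall fun z hz => (hN z hz).norm_deriv_le hη))

theorem abs_intervalIntegral_sub_setIntegral_deriv_le (hw : Continuous w) (hE : IsCompact E)
    (hEQ : E ⊆ Icc a b ×ˢ Icc c d) (hER : IsBoundingRect E a' b' c' d')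
    (hN : ∀ z ∈ E, AxisLipschitz w N η z)
    (hd : ∀ z ∈ E, DifferentiableAt ℝ (fun s => w (s, z.2)) z.1)
    (hη : 0 < η) (hη₁ : b - a ≤ η) (hη₂ : d - c ≤ η) (hκ : d - c ≤ κ * (b - a)) :
    |(∫ t in c'..d', (w (b', t) - w (a', t))) - ∫ z in E, deriv (fun s => w (s, z.2)) z.1| ≤
      N * (1 + 3 * κ) * volume.real ((Icc a b ×ˢ Icc c d) \ E) := by
  have hc'd' : c' ≤ d' := hER.bottom_le_top
  have hsub : Icc c' d' ⊆ Icc c d := Icc_subset_Icc (hER.le_bottom hEQ) (hER.top_le hEQ)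
  have hint := AxisLipschitz.integrableOn_deriv hw hE hη hN
  set D := (Icc a b ×ˢ Icc c d) \ E
  have hDm : MeasurableSet D := (isCompact_rect a b c d).measurableSet.diff hE.measurableSet
  have hDfin : volume D ≠ ⊤ :=
    ne_top_of_le_ne_top (isCompact_rect a b c d).measure_lt_top.ne (measure_mono sdiff_subset)
  have hD := setIntegral_eq_intervalIntegral_slice
    ((hER.le_bottom hEQ).trans (hc'd'.trans (hER.top_le hEQ))) hDm (fun z hz => hz.1.2)
    (integrableOn_const (C := (1 : ℝ)) hDfin)
  have hDint := fun p q => intervalIntegrable_setIntegral_slice hDm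
    (integrableOn_const (C := (1 : ℝ)) hDfin) p q
  simp only [setIntegral_const, smul_eq_mul, mul_one] at hD hDint
  have hwint : IntervalIntegrable (fun t => w (b', t) - w (a', t)) volume c' d' :=
    Continuous.intervalIntegrable (by fun_prop) _ _
  have hslice := intervalIntegrable_setIntegral_slice hE.measurableSet hint c' d'
  rw [setIntegral_eq_intervalIntegral_slice hc'd' hE.measurableSet
    (fun z hz => (hER.subset hz).2) hint, ← intervalIntegral.integral_sub hwint hslice, hD,
    ← intervalIntegral.integral_const_mul]
  calc |∫ t in c'..d', (w (b', t) - w (a', t) -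
        ∫ s in {s | (s, t) ∈ E}, deriv (fun s => w (s, t)) s)|
      ≤ ∫ t in c'..d', N * (1 + 3 * κ) * volume.real {s | (s, t) ∈ D} :=
        (intervalIntegral.abs_integral_le_integral_abs hc'd').trans <|
          intervalIntegral.integral_mono_on hc'd' (hwint.sub hslice).abs ((hDint _ _).const_mul _)
            fun t ht => abs_sub_sub_setIntegral_slice_deriv_le hE.isClosed hEQ hER hN hd hη₁ hη₂ hκ
              (hsub ht)
    _ ≤ ∫ t in c..d, N * (1 + 3 * κ) * volume.real {s | (s, t) ∈ D} :=
        intervalIntegral.integral_mono_interval (hER.le_bottom hEQ) hc'd' (hER.top_le hEQ)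
          (Eventually.of_forall fun t => by positivity) ((hDint _ _).const_mul _)

end Increments

/-- The integral of the 1-form `u ds + v dt` along the positively oriented boundary of
`[a, b] × [c, d]`. -/
def rectIntegral (u v : ℝ × ℝ → ℝ) (a b c d : ℝ) : ℝ :=
  (∫ t in c..d, (v (b, t) - v (a, t))) - ∫ s in a..b, (u (s, d) - u (s, c))

section RectIntegral

variable {u v : ℝ × ℝ → ℝ}

theorem rectIntegral_self_left (u v : ℝ × ℝ → ℝ) (a c d : ℝ) : rectIntegral u v a a c d = 0 := by
  simp [rectIntegral]

theorem rectIntegral_swap (u v : ℝ × ℝ → ℝ) (a b c d : ℝ) :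
    rectIntegral (v ∘ Prod.swap) (u ∘ Prod.swap) c d a b = -rectIntegral u v a b c d := by
  simp [rectIntegral]

theorem rectIntegral_self_right (u v : ℝ × ℝ → ℝ) (a b c : ℝ) : rectIntegral u v a b c c = 0 := by
  simp [rectIntegral]

theorem rectIntegral_add_horizontal (hu : Continuous u) (hv : Continuous v) (a m b c d : ℝ) :
    rectIntegral u v a m c d + rectIntegral u v m b c d = rectIntegral u v a b c d := by
  have hu' : ∀ x y, IntervalIntegrable (fun s => u (s, d) - u (s, c)) volume x y := fun x y =>
    Continuous.intervalIntegrable (by fun_prop) _ _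
  have hv' : ∀ x y, IntervalIntegrable (fun t => v (x, t) - v (y, t)) volume c d := fun x y =>
    Continuous.intervalIntegrable (by fun_prop) _ _
  rw [rectIntegral, rectIntegral, rectIntegral, sub_add_sub_comm,
    ← intervalIntegral.integral_add (hv' _ _) (hv' _ _),
    intervalIntegral.integral_add_adjacent_intervals (hu' a m) (hu' m b)]
  simp only [sub_add_sub_cancel']

theorem rectIntegral_add_vertical (hu : Continuous u) (hv : Continuous v) (a b c m d : ℝ) :
    rectIntegral u v a b c m + rectIntegral u v a b m d = rectIntegral u v a b c d := by
  have := rectIntegral_add_horizontal (hv.comp continuous_swap) (hu.comp continuous_swap) c m d a b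
  simp only [rectIntegral_swap] at this
  linarith

theorem rectIntegral_congr {u' v' : ℝ × ℝ → ℝ} {a b c d : ℝ} (hab : a ≤ b) (hcd : c ≤ d)
    (hu : EqOn u u' (Icc a b ×ˢ Icc c d)) (hv : EqOn v v' (Icc a b ×ˢ Icc c d)) :
    rectIntegral u v a b c d = rectIntegral u' v' a b c d := by
  refine congr_arg₂ _ (intervalIntegral.integral_congr fun t ht => ?_)
    (intervalIntegral.integral_congr fun s hs => ?_)
  · rw [uIcc_of_le hcd] at ht
    exact congr_arg₂ _ (hv ⟨right_mem_Icc.2 hab, ht⟩) (hv ⟨left_mem_Icc.2 hab, ht⟩)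
  · rw [uIcc_of_le hab] at hs
    exact congr_arg₂ _ (hu ⟨hs, right_mem_Icc.2 hcd⟩) (hu ⟨hs, left_mem_Icc.2 hcd⟩)

variable {X : Type*} [TopologicalSpace X]

theorem continuous_intervalIntegral {f : X → ℝ → ℝ} (hf : Continuous (Function.uncurry f))
    {a b : X → ℝ} (ha : Continuous a) (hb : Continuous b) :
    Continuous fun x => ∫ t in a x..b x, f x t := by
  have hi : ∀ x p q, IntervalIntegrable (f x) volume p q := fun x p q =>
    (by fun_prop : Continuous (f x)).intervalIntegrable p q
  have hsub : (fun x => ∫ t in a x..b x, f x t) =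
      fun x => (∫ t in (0 : ℝ)..b x, f x t) - ∫ t in (0 : ℝ)..a x, f x t := funext fun x =>
    (intervalIntegral.integral_interval_sub_left (hi x _ _) (hi x _ _)).symm
  rw [hsub]
  exact (intervalIntegral.continuous_parametric_intervalIntegral_of_continuous hf hb).sub
    (intervalIntegral.continuous_parametric_intervalIntegral_of_continuous hf ha)

theorem continuous_rectIntegral (hu : Continuous u) (hv : Continuous v) {a b c d : X → ℝ}
    (ha : Continuous a) (hb : Continuous b) (hc : Continuous c) (hd : Continuous d) :
    Continuous fun x => rectIntegral u v (a x) (b x) (c x) (d x) :=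
  (continuous_intervalIntegral (f := fun x t => v (b x, t) - v (a x, t))
    (by fun_prop) hc hd).sub
  (continuous_intervalIntegral (f := fun x s => u (s, d x) - u (s, c x)) (by fun_prop) ha hb)

end RectIntegral

theorem rect_induction {F : ℝ → ℝ → ℝ → ℝ → Prop}
    (horizontal : ∀ a m b c d, a ≤ m → m ≤ b → F a m c d → F m b c d → F a b c d)
    (vertical : ∀ a b c m d, c ≤ m → m ≤ d → F a b c m → F a b m d → F a b c d)
    {A B C D : ℝ} (hAB : A ≤ B) (hCD : C ≤ D) (n : ℕ)
    (small : ∀ a b c d, a ≤ b → c ≤ d → b - a = (B - A) / 2 ^ n → d - c = (D - C) / 2 ^ n →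
      Icc a b ⊆ Icc A B → Icc c d ⊆ Icc C D → F a b c d) : F A B C D := by
  induction n with
  | zero => exact small A B C D hAB hCD (by simp) (by simp) subset_rfl subset_rfl
  | succ n ih =>
    refine ih fun a b c d hab hcd hba hdc hX hY => ?_
    have hsmall : ∀ p q r s, p ≤ q → r ≤ s → q - p = (b - a) / 2 → s - r = (d - c) / 2 →
        Icc p q ⊆ Icc a b → Icc r s ⊆ Icc c d → F p q r s :=
      fun p q r s hpq hrs hqp hsr hpq' hrs' =>
        small p q r s hpq hrs (by rw [hqp, hba, pow_succ, div_div])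
          (by rw [hsr, hdc, pow_succ, div_div]) (hpq'.trans hX) (hrs'.trans hY)
    refine horizontal a ((a + b) / 2) b c d (by linarith) (by linarith)
      (vertical _ _ c ((c + d) / 2) d (by linarith) (by linarith) ?_ ?_)
      (vertical _ _ c ((c + d) / 2) d (by linarith) (by linarith) ?_ ?_)
    all_goals
      exact hsmall _ _ _ _ (by linarith) (by linarith) (by ring) (by ring)
        (Icc_subset_Icc (by linarith) (by linarith)) (Icc_subset_Icc (by linarith) (by linarith))

theorem eventually_div_two_pow_lt (x : ℝ) {δ : ℝ} (hδ : 0 < δ) : ∀ᶠ n : ℕ in atTop, x / 2 ^ n < δ :=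
  (tendsto_const_nhds.div_atTop (tendsto_pow_atTop_atTop_of_one_lt one_lt_two)).eventually_lt_const
    hδ

theorem dist_le_of_mem_rect {a b c d δ : ℝ} {z w : ℝ × ℝ} (hz : z ∈ Icc a b ×ˢ Icc c d)
    (hw : w ∈ Icc a b ×ˢ Icc c d) (hab : b - a ≤ δ) (hcd : d - c ≤ δ) : dist z w ≤ δ :=
  max_le ((Real.dist_le_of_mem_Icc hz.1 hw.1).trans hab)
    ((Real.dist_le_of_mem_Icc hz.2 hw.2).trans hcd)

/-- The points near which the 1-form `u ds + v dt` has integral zero along the boundaries of all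
rectangles. The theorem of Looman–Menchoff type below shows that all points are of this kind. -/
def conservativeSet (u v : ℝ × ℝ → ℝ) : Set (ℝ × ℝ) :=
  {z | ∃ r > 0, ∀ a b c d, a ≤ b → c ≤ d → Icc a b ×ˢ Icc c d ⊆ Metric.ball z r →
    rectIntegral u v a b c d = 0}

section ConservativeSet

variable {u v : ℝ × ℝ → ℝ} {a b c d : ℝ}

theorem isOpen_conservativeSet : IsOpen (conservativeSet u v) := by
  rw [Metric.isOpen_iff]
  rintro z ⟨r, hr, h⟩
  refine ⟨r / 2, by positivity, fun y hy => ⟨r / 2, by positivity, fun a b c d hab hcd hsub => ?_⟩⟩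
  refine h a b c d hab hcd (hsub.trans (Metric.ball_subset_ball' ?_))
  linarith [Metric.mem_ball.1 hy]

theorem rectIntegral_eq_zero_of_Icc_subset (hu : Continuous u) (hv : Continuous v)
    (hab : a ≤ b) (hcd : c ≤ d) (h : Icc a b ×ˢ Icc c d ⊆ conservativeSet u v) :
    rectIntegral u v a b c d = 0 := by
  choose! r hr hz using fun (z : ℝ × ℝ) (hz : z ∈ conservativeSet u v) => hz
  obtain ⟨δ, hδ, hL⟩ := lebesgue_number_lemma_of_metric (ι := conservativeSet u v)
    (c := fun z => Metric.ball (z : ℝ × ℝ) (r z)) (isCompact_rect a b c d)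
    (fun _ => Metric.isOpen_ball)
    (fun z hzm => mem_iUnion.2 ⟨⟨z, h hzm⟩, Metric.mem_ball_self (hr z (h hzm))⟩)
  obtain ⟨n, hn₁, hn₂⟩ := ((eventually_div_two_pow_lt (b - a) hδ).and
    (eventually_div_two_pow_lt (d - c) hδ)).exists
  refine rect_induction (F := fun a b c d => rectIntegral u v a b c d = 0) ?_ ?_ hab hcd n ?_
  · intro a m b c d _ _ h₁ h₂
    rw [← rectIntegral_add_horizontal hu hv a m b, h₁, h₂, add_zero]
  · intro a b c m d _ _ h₁ h₂
    rw [← rectIntegral_add_vertical hu hv a b c m, h₁, h₂, add_zero]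
  · intro p q r s hpq hrs hqp hsr hX hY
    have hpr : (p, r) ∈ Icc p q ×ˢ Icc r s := ⟨left_mem_Icc.2 hpq, left_mem_Icc.2 hrs⟩
    obtain ⟨⟨z, hzc⟩, hzb⟩ := hL (p, r) (prod_mono hX hY hpr)
    refine hz z hzc _ _ _ _ hpq hrs (Subset.trans (fun w hw => ?_) hzb)
    exact (dist_le_of_mem_rect hw hpr (le_max_left _ _) (le_max_right _ _)).trans_lt
      (max_lt (hqp.trans_lt hn₁) (hsr.trans_lt hn₂))

theorem rectIntegral_eq_zero_of_Ioo_subset (hu : Continuous u) (hv : Continuous v)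
    (hab : a ≤ b) (hcd : c ≤ d) (h : Ioo a b ×ˢ Ioo c d ⊆ conservativeSet u v) :
    rectIntegral u v a b c d = 0 := by
  rcases hab.eq_or_lt with rfl | hab
  · exact rectIntegral_self_left u v a c d
  rcases hcd.eq_or_lt with rfl | hcd
  · exact rectIntegral_self_right u v a b c
  have hlim : Tendsto (fun τ : ℝ => rectIntegral u v (a + τ) (b - τ) (c + τ) (d - τ)) (𝓝[>] 0)
      (𝓝 (rectIntegral u v a b c d)) := by
    have hcont : Continuous fun τ : ℝ => rectIntegral u v (a + τ) (b - τ) (c + τ) (d - τ) :=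
      continuous_rectIntegral hu hv (by fun_prop) (by fun_prop) (by fun_prop) (by fun_prop)
    simpa using (hcont.tendsto 0).mono_left nhdsWithin_le_nhds
  refine tendsto_nhds_unique hlim (tendsto_const_nhds.congr' ?_)
  filter_upwards [self_mem_nhdsWithin, Ioo_mem_nhdsGT (half_pos (sub_pos.2 hab)),
    Ioo_mem_nhdsGT (half_pos (sub_pos.2 hcd))] with τ (hτ : 0 < τ) hτ₁ hτ₂
  refine (rectIntegral_eq_zero_of_Icc_subset hu hv (by linarith [hτ₁.2]) (by linarith [hτ₂.2])
    (Subset.trans (prod_mono ?_ ?_) h)).symm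
  all_goals exact Icc_subset_Ioo (by linarith) (by linarith)

theorem rectIntegral_eq_of_sdiff_subset (hu : Continuous u) (hv : Continuous v)
    {a' b' c' d' : ℝ} (ha : a ≤ a') (hab : a' ≤ b') (hb : b' ≤ b)
    (hc : c ≤ c') (hcd : c' ≤ d') (hd : d' ≤ d)
    (h : (Icc a b ×ˢ Icc c d) \ (Icc a' b' ×ˢ Icc c' d') ⊆ conservativeSet u v) :
    rectIntegral u v a b c d = rectIntegral u v a' b' c' d' := by
  have hcd' : c ≤ d := hc.trans (hcd.trans hd)
  have hout : ∀ s ∈ Icc a b, ∀ t ∈ Icc c d, (s < a' ∨ b' < s ∨ t < c' ∨ d' < t) →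
      (s, t) ∈ conservativeSet u v := by
    refine fun s hs t ht hst => h ⟨⟨hs, ht⟩, fun hmem => ?_⟩
    obtain ⟨⟨h₁, h₂⟩, h₃, h₄⟩ := hmem
    exact hst.elim h₁.not_gt fun hst => hst.elim h₂.not_gt fun hst => hst.elim h₃.not_gt h₄.not_gt
  have hleft : rectIntegral u v a a' c d = 0 :=
    rectIntegral_eq_zero_of_Ioo_subset hu hv ha hcd' fun z hz => hout _
      ⟨hz.1.1.le, by linarith [hz.1.2]⟩ _ (Ioo_subset_Icc_self hz.2) (.inl hz.1.2)
  have hright : rectIntegral u v b' b c d = 0 :=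
    rectIntegral_eq_zero_of_Ioo_subset hu hv hb hcd' fun z hz => hout _
      ⟨by linarith [hz.1.1], hz.1.2.le⟩ _ (Ioo_subset_Icc_self hz.2) (.inr (.inl hz.1.1))
  have hbottom : rectIntegral u v a' b' c c' = 0 :=
    rectIntegral_eq_zero_of_Ioo_subset hu hv hab hc fun z hz => hout _
      ⟨by linarith [hz.1.1], by linarith [hz.1.2]⟩ _ ⟨hz.2.1.le, by linarith [hz.2.2]⟩
      (.inr (.inr (.inl hz.2.2)))
  have htop : rectIntegral u v a' b' d' d = 0 :=
    rectIntegral_eq_zero_of_Ioo_subset hu hv hab hd fun z hz => hout _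
      ⟨by linarith [hz.1.1], by linarith [hz.1.2]⟩ _ ⟨by linarith [hz.2.1], hz.2.2.le⟩
      (.inr (.inr (.inr hz.2.1)))
  rw [← rectIntegral_add_horizontal hu hv a a' b, ← rectIntegral_add_horizontal hu hv a' b' b,
    ← rectIntegral_add_vertical hu hv a' b' c c' d,
    ← rectIntegral_add_vertical hu hv a' b' c' d' d, hleft, hright, hbottom, htop]
  ring

end ConservativeSet

/-- At `z` the partial derivatives of `u` and `v` exist and the form `u ds + v dt` is closed; no
differentiability of `u` and `v` as functions of two variables is required. -/
structure IsCurlFreeAt (u v : ℝ × ℝ → ℝ) (z : ℝ × ℝ) : Prop where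
  differentiableAt_u_fst : DifferentiableAt ℝ (fun s => u (s, z.2)) z.1
  differentiableAt_u_snd : DifferentiableAt ℝ (fun t => u (z.1, t)) z.2
  differentiableAt_v_fst : DifferentiableAt ℝ (fun s => v (s, z.2)) z.1
  differentiableAt_v_snd : DifferentiableAt ℝ (fun t => v (z.1, t)) z.2
  deriv_eq : deriv (fun s => v (s, z.2)) z.1 = deriv (fun t => u (z.1, t)) z.2

theorem IsCurlFreeAt.congr {u v u' v' : ℝ × ℝ → ℝ} {z : ℝ × ℝ} (h : IsCurlFreeAt u v z)
    (hu : u' =ᶠ[𝓝 z] u) (hv : v' =ᶠ[𝓝 z] v) : IsCurlFreeAt u' v' z := by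
  have hfst : Tendsto (fun s : ℝ => (s, z.2)) (𝓝 z.1) (𝓝 z) :=
    (by fun_prop : Continuous fun s : ℝ => (s, z.2)).tendsto z.1
  have hsnd : Tendsto (fun t : ℝ => (z.1, t)) (𝓝 z.2) (𝓝 z) :=
    (by fun_prop : Continuous fun t : ℝ => (z.1, t)).tendsto z.2
  exact ⟨h.differentiableAt_u_fst.congr_of_eventuallyEq (hu.comp_tendsto hfst),
    h.differentiableAt_u_snd.congr_of_eventuallyEq (hu.comp_tendsto hsnd),
    h.differentiableAt_v_fst.congr_of_eventuallyEq (hv.comp_tendsto hfst),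
    h.differentiableAt_v_snd.congr_of_eventuallyEq (hv.comp_tendsto hsnd),
    (hv.comp_tendsto hfst).deriv_eq.trans
      (h.deriv_eq.trans (hu.comp_tendsto hsnd).deriv_eq.symm)⟩

theorem measureReal_Ioc_prod_add (ν : Measure (ℝ × ℝ)) [IsFiniteMeasure ν] {a m b : ℝ}
    (ham : a ≤ m) (hmb : m ≤ b) {T : Set ℝ} (hT : MeasurableSet T) :
    ν.real (Ioc a m ×ˢ T) + ν.real (Ioc m b ×ˢ T) = ν.real (Ioc a b ×ˢ T) := by
  rw [← Ioc_union_Ioc_eq_Ioc ham hmb, union_prod,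
    measureReal_union (disjoint_prod.2 (.inl (Ioc_disjoint_Ioc_of_le le_rfl)))
      (measurableSet_Ioc.prod hT)]

theorem measureReal_prod_Ioc_add (ν : Measure (ℝ × ℝ)) [IsFiniteMeasure ν] {c m d : ℝ}
    (hcm : c ≤ m) (hmd : m ≤ d) {S : Set ℝ} (hS : MeasurableSet S) :
    ν.real (S ×ˢ Ioc c m) + ν.real (S ×ˢ Ioc m d) = ν.real (S ×ˢ Ioc c d) := by
  rw [← Ioc_union_Ioc_eq_Ioc hcm hmd, prod_union,
    measureReal_union (disjoint_prod.2 (.inr (Ioc_disjoint_Ioc_of_le le_rfl)))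
      (hS.prod measurableSet_Ioc)]

theorem tendsto_measureReal_cthickening_sdiff {X : Type*} [MetricSpace X] [ProperSpace X]
    [MeasurableSpace X] [OpensMeasurableSpace X] (μ : Measure X) [IsFiniteMeasureOnCompacts μ]
    {E : Set X} (hE : IsCompact E) :
    Tendsto (fun δ => μ.real (Metric.cthickening δ E \ E)) (𝓝 0) (𝓝 0) := by
  have hlim : Tendsto (fun δ => μ.real (Metric.cthickening δ E)) (𝓝 0) (𝓝 (μ.real E)) :=
    (ENNReal.tendsto_toReal hE.measure_lt_top.ne).comp (tendsto_measure_cthickening_of_isCompact hE)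
  have hsdiff : ∀ δ, μ.real (Metric.cthickening δ E \ E) =
      μ.real (Metric.cthickening δ E) - μ.real E := fun δ =>
    measureReal_sdiff (Metric.self_subset_cthickening E) hE.measurableSet
      hE.cthickening.measure_lt_top.ne
  simpa only [hsdiff, sub_self] using hlim.sub_const (μ.real E)

section LoomanMenchoff

variable {u v : ℝ × ℝ → ℝ} {a b c d η : ℝ} {N κ : ℝ≥0}

theorem abs_intervalIntegral_sub_setIntegral_deriv_snd_le {w : ℝ × ℝ → ℝ} {a' b' c' d' : ℝ}
    {E : Set (ℝ × ℝ)} (hw : Continuous w) (hE : IsCompact E)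
    (hEQ : E ⊆ Icc a b ×ˢ Icc c d) (hER : IsBoundingRect E a' b' c' d')
    (hN : ∀ z ∈ E, AxisLipschitz w N η z)
    (hd : ∀ z ∈ E, DifferentiableAt ℝ (fun t => w (z.1, t)) z.2)
    (hη : 0 < η) (hη₁ : b - a ≤ η) (hη₂ : d - c ≤ η) (hκ : b - a ≤ κ * (d - c)) :
    |(∫ s in a'..b', (w (s, d') - w (s, c'))) - ∫ z in E, deriv (fun t => w (z.1, t)) z.2| ≤
      N * (1 + 3 * κ) * volume.real ((Icc a b ×ˢ Icc c d) \ E) := by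
  have hswap : MeasurePreserving (Prod.swap : ℝ × ℝ → ℝ × ℝ) volume volume :=
    Measure.measurePreserving_swap
  have hemb : MeasurableEmbedding (Prod.swap : ℝ × ℝ → ℝ × ℝ) :=
    MeasurableEquiv.prodComm.measurableEmbedding
  have hbound := abs_intervalIntegral_sub_setIntegral_deriv_le (E := Prod.swap ⁻¹' E)
    (hw.comp continuous_swap) ((Homeomorph.prodComm ℝ ℝ).isCompact_preimage.2 hE)
    (fun z hz => (hEQ hz).symm) hER.swap (fun z hz => (hN _ hz).swap) (fun z hz => hd _ hz)
    hη hη₂ hη₁ hκ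
  rw [← preimage_swap_prod, ← preimage_sdiff, measureReal_def,
    hswap.measure_preimage_emb hemb] at hbound
  rwa [← hswap.setIntegral_preimage_emb hemb (fun z => deriv (fun t => w (z.1, t)) z.2) E]

theorem abs_rectIntegral_le (hu : Continuous u) (hv : Continuous v) (hab : a ≤ b) (hcd : c ≤ d)
    (hη : 0 < η) (hη₁ : b - a ≤ η) (hη₂ : d - c ≤ η)
    (hκ₁ : d - c ≤ κ * (b - a)) (hκ₂ : b - a ≤ κ * (d - c))
    (hN : ∀ z ∈ (Icc a b ×ˢ Icc c d) \ conservativeSet u v,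
      AxisLipschitz u N η z ∧ AxisLipschitz v N η z)
    (hcurl : ∀ z ∈ (Icc a b ×ˢ Icc c d) \ conservativeSet u v, IsCurlFreeAt u v z) :
    |rectIntegral u v a b c d| ≤
      2 * (N * (1 + 3 * κ)) * volume.real ((Icc a b ×ˢ Icc c d) ∩ conservativeSet u v) := by
  set Q := Icc a b ×ˢ Icc c d
  set E := Q \ conservativeSet u v with hE
  have hEc : IsCompact E := (isCompact_rect a b c d).diff isOpen_conservativeSet
  have hEQ : E ⊆ Q := sdiff_subset
  rcases E.eq_empty_or_nonempty with h0 | hne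
  · rw [rectIntegral_eq_zero_of_Icc_subset hu hv hab hcd (sdiff_eq_empty.1 h0), abs_zero]
    positivity
  obtain ⟨a', b', c', d', hER⟩ := exists_isBoundingRect hEc hne
  rw [rectIntegral_eq_of_sdiff_subset hu hv (hER.le_left hEQ) hER.left_le_right (hER.right_le hEQ)
    (hER.le_bottom hEQ) hER.bottom_le_top (hER.top_le hEQ)
    fun z hz => by_contra fun hzG => hz.2 (hER.subset ⟨hz.1, hzG⟩)]
  have hv_incr := abs_intervalIntegral_sub_setIntegral_deriv_le hv hEc hEQ hER
    (fun z hz => (hN z hz).2) (fun z hz => (hcurl z hz).differentiableAt_v_fst) hη hη₁ hη₂ hκ₁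
  have hu_incr := abs_intervalIntegral_sub_setIntegral_deriv_snd_le hu hEc hEQ hER
    (fun z hz => (hN z hz).1) (fun z hz => (hcurl z hz).differentiableAt_u_snd) hη hη₁ hη₂ hκ₂
  rw [← setIntegral_congr_fun hEc.measurableSet fun z hz => (hcurl z hz).deriv_eq] at hu_incr
  rw [hE, sdiff_sdiff_right_self, ← hE] at hv_incr hu_incr
  calc |rectIntegral u v a' b' c' d'| = _ := by
        rw [rectIntegral, ← sub_sub_sub_cancel_right _ _
          (∫ z in E, deriv (fun s => v (s, z.2)) z.1)]
    _ ≤ _ := (abs_sub _ _).trans (add_le_add hv_incr hu_incr)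
    _ = _ := by rw [two_mul, add_mul]

theorem measureReal_rect_inter_le {E G : Set (ℝ × ℝ)} {δ : ℝ} (hE : Bornology.IsBounded E)
    (hEG : Disjoint G E) (hne : ((Icc a b ×ˢ Icc c d) ∩ E).Nonempty) (hab : b - a ≤ δ)
    (hcd : d - c ≤ δ) :
    volume.real ((Icc a b ×ˢ Icc c d) ∩ G) ≤
      (volume.restrict (Metric.cthickening δ E \ E)).real (Ioc a b ×ˢ Ioc c d) := by
  obtain ⟨e, heQ, heE⟩ := hne
  have hae : (Ioc a b ×ˢ Ioc c d : Set (ℝ × ℝ)) =ᵐ[volume.restrict (Metric.cthickening δ E \ E)]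
      (Icc a b ×ˢ Icc c d : Set (ℝ × ℝ)) :=
    ae_restrict_of_ae (Measure.set_prod_ae_eq Ioc_ae_eq_Icc Ioc_ae_eq_Icc)
  rw [measureReal_congr hae, measureReal_restrict_apply (isCompact_rect a b c d).measurableSet]
  refine measureReal_mono (fun z hz => ⟨hz.1, ?_, hEG.notMem_of_mem_left hz.2⟩)
    (ne_top_of_le_ne_top hE.cthickening.measure_lt_top.ne
      (measure_mono (inter_subset_right.trans sdiff_subset)))
  exact Metric.mem_cthickening_of_dist_le z e δ E heE (dist_le_of_mem_rect hz.1 heQ hab hcd)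

theorem abs_rectIntegral_le_mul_measureReal (hu : Continuous u) (hv : Continuous v)
    (ν : Measure (ℝ × ℝ)) [IsFiniteMeasure ν] (hab : a ≤ b) (hcd : c ≤ d) (C : ℝ) (n : ℕ)
    (small : ∀ p q r s, p ≤ q → r ≤ s → q - p = (b - a) / 2 ^ n → s - r = (d - c) / 2 ^ n →
      Icc p q ⊆ Icc a b → Icc r s ⊆ Icc c d →
      |rectIntegral u v p q r s| ≤ C * ν.real (Ioc p q ×ˢ Ioc r s)) :
    |rectIntegral u v a b c d| ≤ C * ν.real (Ioc a b ×ˢ Ioc c d) := by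
  refine rect_induction
    (F := fun p q r s => |rectIntegral u v p q r s| ≤ C * ν.real (Ioc p q ×ˢ Ioc r s))
    ?_ ?_ hab hcd n small
  · intro p m q r s hpm hmq h₁ h₂
    rw [← rectIntegral_add_horizontal hu hv p m q,
      ← measureReal_Ioc_prod_add _ hpm hmq measurableSet_Ioc, mul_add]
    exact (abs_add_le _ _).trans (add_le_add h₁ h₂)
  · intro p q r m s hrm hms h₁ h₂
    rw [← rectIntegral_add_vertical hu hv p q r m,
      ← measureReal_prod_Ioc_add _ hrm hms measurableSet_Ioc, mul_add]
    exact (abs_add_le _ _).trans (add_le_add h₁ h₂)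

theorem abs_rectIntegral_le_cthickening (hu : Continuous u) (hv : Continuous v)
    (hab : a ≤ b) (hcd : c ≤ d) (hη : 0 < η) (hη₁ : b - a ≤ η) (hη₂ : d - c ≤ η)
    (hκ₁ : d - c ≤ κ * (b - a)) (hκ₂ : b - a ≤ κ * (d - c))
    (hN : ∀ z ∈ (Icc a b ×ˢ Icc c d) \ conservativeSet u v,
      AxisLipschitz u N η z ∧ AxisLipschitz v N η z)
    (hcurl : ∀ z ∈ (Icc a b ×ˢ Icc c d) \ conservativeSet u v, IsCurlFreeAt u v z)
    {δ : ℝ} (hδ : 0 < δ) :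
    |rectIntegral u v a b c d| ≤ 2 * (N * (1 + 3 * κ)) * volume.real
      (Metric.cthickening δ ((Icc a b ×ˢ Icc c d) \ conservativeSet u v) \
        ((Icc a b ×ˢ Icc c d) \ conservativeSet u v)) := by
  set G := conservativeSet u v
  set E := (Icc a b ×ˢ Icc c d) \ G
  have hE : IsCompact E := (isCompact_rect a b c d).diff isOpen_conservativeSet
  set T := Metric.cthickening δ E \ E
  have hT : volume T ≠ ⊤ :=
    ne_top_of_le_ne_top hE.cthickening.measure_lt_top.ne (measure_mono sdiff_subset)
  have : IsFiniteMeasure (volume.restrict T) := isFiniteMeasure_restrict.2 hT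
  obtain ⟨n, hn₁, hn₂⟩ := ((eventually_div_two_pow_lt (b - a) hδ).and
    (eventually_div_two_pow_lt (d - c) hδ)).exists
  suffices h : |rectIntegral u v a b c d| ≤
      2 * (N * (1 + 3 * κ)) * (volume.restrict T).real (Ioc a b ×ˢ Ioc c d) by
    rw [measureReal_restrict_apply (measurableSet_Ioc.prod measurableSet_Ioc)] at h
    exact h.trans (by gcongr; exact inter_subset_right)
  refine abs_rectIntegral_le_mul_measureReal hu hv _ hab hcd _ n
    fun p q r s hpq hrs hqp hsr hX hY => ?_
  have hsub : (Icc p q ×ˢ Icc r s) \ G ⊆ E := sdiff_subset_sdiff_left (prod_mono hX hY)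
  have hpow : (1 : ℝ) ≤ 2 ^ n := one_le_pow₀ one_le_two
  rcases ((Icc p q ×ˢ Icc r s) \ G).eq_empty_or_nonempty with h0 | ⟨e, he⟩
  · rw [rectIntegral_eq_zero_of_Icc_subset hu hv hpq hrs (sdiff_eq_empty.1 h0), abs_zero]
    positivity
  refine (abs_rectIntegral_le hu hv hpq hrs hη
    (hqp.trans_le ((div_le_self (sub_nonneg.2 hab) hpow).trans hη₁))
    (hsr.trans_le ((div_le_self (sub_nonneg.2 hcd) hpow).trans hη₂))
    (by rw [hqp, hsr, ← mul_div_assoc]; gcongr) (by rw [hqp, hsr, ← mul_div_assoc]; gcongr)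
    (fun z hz => hN z (hsub hz)) fun z hz => hcurl z (hsub hz)).trans ?_
  gcongr
  exact measureReal_rect_inter_le hE.isBounded disjoint_sdiff_right ⟨e, he.1, hsub he⟩
    (hqp.trans_lt hn₁).le (hsr.trans_lt hn₂).le

theorem exists_aspectRatio (hab : a < b) (hcd : c < d) :
    ∃ κ : ℝ≥0, d - c ≤ κ * (b - a) ∧ b - a ≤ κ * (d - c) := by
  have hba : 0 < b - a := sub_pos.2 hab
  have hdc : 0 < d - c := sub_pos.2 hcd
  refine ⟨⟨max ((d - c) / (b - a)) ((b - a) / (d - c)), by positivity⟩, ?_, ?_⟩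
  · exact (div_le_iff₀ hba).1 (le_max_left _ _)
  · exact (div_le_iff₀ hdc).1 (le_max_right _ _)

theorem rectIntegral_eq_zero_of_axisLipschitz (hu : Continuous u) (hv : Continuous v)
    (hab : a ≤ b) (hcd : c ≤ d) (hη : 0 < η) (hη₁ : b - a ≤ η) (hη₂ : d - c ≤ η)
    (hN : ∀ z ∈ (Icc a b ×ˢ Icc c d) \ conservativeSet u v,
      AxisLipschitz u N η z ∧ AxisLipschitz v N η z)
    (hcurl : ∀ z ∈ (Icc a b ×ˢ Icc c d) \ conservativeSet u v, IsCurlFreeAt u v z) :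
    rectIntegral u v a b c d = 0 := by
  rcases hab.eq_or_lt with rfl | hab'
  · exact rectIntegral_self_left u v a c d
  rcases hcd.eq_or_lt with rfl | hcd'
  · exact rectIntegral_self_right u v a b c
  obtain ⟨κ, hκ₁, hκ₂⟩ := exists_aspectRatio hab' hcd'
  have hE : IsCompact ((Icc a b ×ˢ Icc c d) \ conservativeSet u v) :=
    (isCompact_rect a b c d).diff isOpen_conservativeSet
  have hlim := ((tendsto_measureReal_cthickening_sdiff volume hE).mono_left
    (nhdsWithin_le_nhds (s := Ioi 0))).const_mul (2 * ((N : ℝ) * (1 + 3 * κ)))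
  rw [mul_zero] at hlim
  refine abs_nonpos_iff.1 (ge_of_tendsto hlim (eventually_mem_nhdsWithin.mono fun δ hδ => ?_))
  exact abs_rectIntegral_le_cthickening hu hv hab hcd hη hη₁ hη₂ hκ₁ hκ₂ hN hcurl hδ

-- By Baire's theorem: `P` is the union of the relatively closed sets of uniform Lipschitz points.
theorem exists_forall_mem_ball_axisLipschitz (hu : Continuous u) (hv : Continuous v)
    {P : Set (ℝ × ℝ)} (hP : IsGδ P) (hne : P.Nonempty) (hcurl : ∀ z ∈ P, IsCurlFreeAt u v z) :
    ∃ p ∈ P, ∃ N : ℝ≥0, ∃ η > 0, ∀ z ∈ P ∩ Metric.ball p η,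
      AxisLipschitz u N η z ∧ AxisLipschitz v N η z := by
  have : BaireSpace P := hP.baireSpace_of_t2Space_locallyCompactSpace
  have : Nonempty P := hne.to_subtype
  let M : ℕ → ℝ≥0 := fun n => (n + 1 : ℕ)
  let f : ℕ → Set P := fun n =>
    {z | AxisLipschitz u (M n) (M n : ℝ)⁻¹ z ∧ AxisLipschitz v (M n) (M n : ℝ)⁻¹ z}
  have hf : ∀ n, IsClosed (f n) := fun n =>
    ((isClosed_setOf_axisLipschitz hu _ _).inter (isClosed_setOf_axisLipschitz hv _ _)).preimage
      continuous_subtype_val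
  have hM : Tendsto M atTop atTop := tendsto_natCast_atTop_atTop.comp (tendsto_add_atTop_nat 1)
  have hcover : ⋃ n, f n = univ := eq_univ_of_forall fun z => mem_iUnion.2 <| by
    have hz := hcurl z z.2
    exact ((hM.eventually (eventually_axisLipschitz hz.differentiableAt_u_fst
      hz.differentiableAt_u_snd)).and (hM.eventually (eventually_axisLipschitz
        hz.differentiableAt_v_fst hz.differentiableAt_v_snd))).exists
  obtain ⟨n, p, hp⟩ := nonempty_interior_of_iUnion_of_closed hf hcover
  obtain ⟨ε, hε, hball⟩ := Metric.mem_nhds_iff.1 (mem_interior_iff_mem_nhds.1 hp)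
  have hMn : (0 : ℝ) < M n := NNReal.coe_pos.2 (Nat.cast_pos.2 n.succ_pos)
  refine ⟨p, p.2, M n, min ε (M n : ℝ)⁻¹, lt_min hε (inv_pos.2 hMn), fun z hz => ?_⟩
  have hzf : (⟨z, hz.1⟩ : P) ∈ f n :=
    hball ((Metric.mem_ball.1 hz.2).trans_le (min_le_left _ _))
  exact ⟨hzf.1.anti (min_le_right _ _), hzf.2.anti (min_le_right _ _)⟩

theorem subset_conservativeSet (hu : Continuous u) (hv : Continuous v) {O : Set (ℝ × ℝ)}
    (hO : IsOpen O) (hcurl : ∀ z ∈ O, IsCurlFreeAt u v z) : O ⊆ conservativeSet u v := by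
  by_contra hsub
  obtain ⟨p, ⟨hpO, hpG⟩, N, η, hη, hN⟩ := exists_forall_mem_ball_axisLipschitz hu hv
    (hO.isGδ.inter isOpen_conservativeSet.isClosed_compl.isGδ) (not_subset.1 hsub)
    (fun z hz => hcurl z hz.1)
  obtain ⟨r, hr, hrO⟩ := Metric.isOpen_iff.1 hO p hpO
  refine hpG ⟨min r (η / 2), by positivity, fun a b c d hab hcd hball => ?_⟩
  have hmem : ∀ z ∈ (Icc a b ×ˢ Icc c d) \ conservativeSet u v,
      z ∈ (O ∩ (conservativeSet u v)ᶜ) ∩ Metric.ball p η := fun z hz =>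
    ⟨⟨hrO (Metric.ball_subset_ball (min_le_left _ _) (hball hz.1)), hz.2⟩, Metric.ball_subset_ball
      ((min_le_right _ _).trans (half_le_self hη.le)) (hball hz.1)⟩
  have hdist : dist (b, d) (a, c) ≤ η := by
    have hac := hball (mk_mem_prod (left_mem_Icc.2 hab) (left_mem_Icc.2 hcd))
    have hbd := hball (mk_mem_prod (right_mem_Icc.2 hab) (right_mem_Icc.2 hcd))
    rw [Metric.mem_ball, lt_min_iff] at hac hbd
    linarith [dist_triangle_right (b, d) (a, c) p]
  rw [Prod.dist_eq, Real.dist_eq, Real.dist_eq, max_le_iff] at hdist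
  exact rectIntegral_eq_zero_of_axisLipschitz hu hv hab hcd hη ((le_abs_self _).trans hdist.1)
    ((le_abs_self _).trans hdist.2) (fun z hz => hN z (hmem z hz))
    fun z hz => hcurl z (hmem z hz).1.1

theorem continuous_clamp {f : ℝ × ℝ → ℝ} (hab : a ≤ b) (hcd : c ≤ d)
    (hf : ContinuousOn f (Icc a b ×ˢ Icc c d)) :
    Continuous fun z : ℝ × ℝ => f (projIcc a b hab z.1, projIcc c d hcd z.2) :=
  hf.comp_continuous (by fun_prop) fun z => ⟨(projIcc a b hab z.1).2, (projIcc c d hcd z.2).2⟩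

theorem rectIntegral_eq_zero_of_isCurlFreeAt (hab : a ≤ b) (hcd : c ≤ d)
    (hu : ContinuousOn u (Icc a b ×ˢ Icc c d)) (hv : ContinuousOn v (Icc a b ×ˢ Icc c d))
    (hcurl : ∀ z ∈ Ioo a b ×ˢ Ioo c d, IsCurlFreeAt u v z) : rectIntegral u v a b c d = 0 := by
  have hclamp : ∀ f : ℝ × ℝ → ℝ, EqOn f (fun z => f (projIcc a b hab z.1, projIcc c d hcd z.2))
      (Icc a b ×ˢ Icc c d) := fun f z hz => by
    simp only [projIcc_of_mem hab hz.1, projIcc_of_mem hcd hz.2]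
  have hopen : IsOpen (Ioo a b ×ˢ Ioo c d) := isOpen_Ioo.prod isOpen_Ioo
  have hnear : ∀ f : ℝ × ℝ → ℝ, ∀ z ∈ Ioo a b ×ˢ Ioo c d,
      (fun z : ℝ × ℝ => f (projIcc a b hab z.1, projIcc c d hcd z.2)) =ᶠ[𝓝 z] f := fun f z hz => by
    filter_upwards [hopen.mem_nhds hz] with w hw
    exact (hclamp f (prod_mono Ioo_subset_Icc_self Ioo_subset_Icc_self hw)).symm
  rw [rectIntegral_congr hab hcd (hclamp u) (hclamp v)]
  have hu' := continuous_clamp hab hcd hu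
  have hv' := continuous_clamp hab hcd hv
  exact rectIntegral_eq_zero_of_Ioo_subset hu' hv' hab hcd
    (subset_conservativeSet hu' hv' hopen fun z hz =>
      (hcurl z hz).congr (hnear u z hz) (hnear v z hz))

end LoomanMenchoff

section ClosedForms

variable {V : Type*} [NormedAddCommGroup V] [NormedSpace ℝ V] {ω : V → V →L[ℝ] ℝ} {S W : Set V}

/-- A continuous 1-form `ω` is Gateaux closed on `W` if at every point of `W` its directional
derivatives `(h, h') ↦ ∂_h ω(h')` exist and form a symmetric bilinear form. No Fréchet
differentiability is required. -/
structure IsGateauxClosedOn (ω : V → V →L[ℝ] ℝ) (W : Set V) : Prop where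
  continuousOn : ContinuousOn ω W
  hasLineDerivAt : ∀ x ∈ W, ∃ B : V →ₗ[ℝ] V →ₗ[ℝ] ℝ, (∀ h h', B h h' = B h' h) ∧
    ∀ h h', HasLineDerivAt ℝ (fun y => ω y h') (B h h') x h

theorem IsGateauxClosedOn.mono (hω : IsGateauxClosedOn ω W) (h : S ⊆ W) :
    IsGateauxClosedOn ω S :=
  ⟨hω.continuousOn.mono h, fun x hx => hω.hasLineDerivAt x (h hx)⟩

theorem hasDerivAt_comp_add_smul {f : V → ℝ} {f' s : ℝ} {x v : V}
    (h : HasLineDerivAt ℝ f f' (x + s • v) v) : HasDerivAt (fun r : ℝ => f (x + r • v)) f' s := by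
  have h0 : HasDerivAt (fun t : ℝ => f (x + s • v + t • v)) f' (s - s) := by
    rw [sub_self]
    exact h
  refine (h0.comp_sub_const s s).congr_of_eventuallyEq (.of_forall fun r => ?_)
  simp only [add_assoc, ← add_smul, add_sub_cancel]

/-- The first component of the pull-back of the 1-form `ω` under the parametrization
`(s, t) ↦ x + s (p + t q)` of the triangle with vertices `x`, `x + p`, `x + p + q`. -/
def coneFst (ω : V → V →L[ℝ] ℝ) (x p q : V) (σ : ℝ × ℝ) : ℝ :=
  ω (x + σ.1 • (p + σ.2 • q)) (p + σ.2 • q)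

/-- The second component of the pull-back of the 1-form `ω` under the parametrization
`(s, t) ↦ x + s (p + t q)` of the triangle with vertices `x`, `x + p`, `x + p + q`. -/
def coneSnd (ω : V → V →L[ℝ] ℝ) (x p q : V) (σ : ℝ × ℝ) : ℝ :=
  σ.1 * ω (x + σ.1 • (p + σ.2 • q)) q

theorem IsGateauxClosedOn.isCurlFreeAt_cone (hω : IsGateauxClosedOn ω W) {x p q : V} {σ : ℝ × ℝ}
    (hσ : x + σ.1 • (p + σ.2 • q) ∈ W) :
    IsCurlFreeAt (coneFst ω x p q) (coneSnd ω x p q) σ := by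
  obtain ⟨s, t⟩ := σ
  obtain ⟨B, hB, hd⟩ := hω.hasLineDerivAt _ hσ
  have hs (h' : V) : HasDerivAt (fun r => ω (x + r • (p + t • q)) h') (B (p + t • q) h') s :=
    hasDerivAt_comp_add_smul (hd _ h')
  have htrans (r : ℝ) : x + s • (p + r • q) = x + s • p + r • s • q := by
    rw [smul_add, smul_comm r s, add_assoc]
  have ht (h' : V) : HasDerivAt (fun r => ω (x + s • (p + r • q)) h') (B (s • q) h') t := by
    simp only [htrans]
    exact hasDerivAt_comp_add_smul (by simpa only [htrans] using hd (s • q) h')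
  have hut : HasDerivAt (fun r => coneFst ω x p q (s, r))
      (B (s • q) p + (ω (x + s • (p + t • q)) q + t * B (s • q) q)) t := by
    refine (((ht p).add ((hasDerivAt_id t).mul (ht q))).congr_deriv (by simp)).congr_of_eventuallyEq
      (.of_forall fun r => ?_)
    simp [coneFst]
  have hvs : HasDerivAt (fun r => coneSnd ω x p q (r, t))
      (ω (x + s • (p + t • q)) q + s * B (p + t • q) q) s :=
    ((hasDerivAt_id s).mul (hs q)).congr_deriv (by simp)
  refine ⟨(hs (p + t • q)).differentiableAt, hut.differentiableAt, hvs.differentiableAt,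
    ((ht q).const_mul s).differentiableAt, ?_⟩
  rw [hvs.deriv, hut.deriv]
  simp only [map_add, map_smul, LinearMap.add_apply, LinearMap.smul_apply, smul_eq_mul, hB p q]
  ring

theorem curveIntegrable_segment_of_continuousOn (hω : ContinuousOn ω S) {x y : V}
    (h : segment ℝ x y ⊆ S) : CurveIntegrable ω (.segment x y) := by
  rw [curveIntegrable_segment]
  refine ContinuousOn.intervalIntegrable ?_
  rw [uIcc_of_le zero_le_one]
  exact (hω.comp AffineMap.lineMap_continuous.continuousOn fun t ht =>
    h (lineMap_mem_segment ℝ x y ht)).clm_apply continuousOn_const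

theorem rectIntegral_cone (hS : Convex ℝ S) (hω : ContinuousOn ω S) {x y z : V} (hx : x ∈ S)
    (hy : y ∈ S) (hz : z ∈ S) :
    rectIntegral (coneFst ω x (y - x) (z - y)) (coneSnd ω x (y - x) (z - y)) 0 1 0 1 =
      (∫ᶜ a in .segment x y, ω a) + (∫ᶜ a in .segment y z, ω a) -
        ∫ᶜ a in .segment x z, ω a := by
  have hxy := curveIntegrable_segment_of_continuousOn hω (hS.segment_subset hx hy)
  have hxz := curveIntegrable_segment_of_continuousOn hω (hS.segment_subset hx hz)
  rw [curveIntegrable_segment] at hxy hxz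
  have hxt (t : ℝ) : x + (y - x + t • (z - y)) = y + t • (z - y) := by abel
  simp only [curveIntegral_segment, AffineMap.lineMap_apply_module', add_comm _ x,
    add_comm _ y] at hxy hxz ⊢
  simp only [rectIntegral, coneFst, coneSnd, one_smul, one_mul, zero_mul, zero_smul, add_zero,
    sub_zero, hxt, sub_add_sub_cancel', intervalIntegral.integral_sub hxz hxy]
  ring

theorem IsGateauxClosedOn.curveIntegral_segment_add (hω : IsGateauxClosedOn ω S)
    (hS : Convex ℝ S) {x y z : V} (hx : x ∈ S) (hy : y ∈ S) (hz : z ∈ S) :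
    (∫ᶜ a in .segment x y, ω a) + ∫ᶜ a in .segment y z, ω a = ∫ᶜ a in .segment x z, ω a := by
  have hmem : MapsTo (fun σ : ℝ × ℝ => x + σ.1 • (y - x + σ.2 • (z - y)))
      (Icc 0 1 ×ˢ Icc 0 1) S := fun σ hσ => by
    have := hS.add_smul_sub_mem hx (hS.add_smul_sub_mem hy hz hσ.2) hσ.1
    rwa [add_sub_right_comm] at this
  have hcomp := hω.continuousOn.comp (by fun_prop) hmem
  rw [← sub_eq_zero, ← rectIntegral_cone hS hω.continuousOn hx hy hz]
  refine rectIntegral_eq_zero_of_isCurlFreeAt zero_le_one zero_le_one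
    (hcomp.clm_apply (by fun_prop)) (continuousOn_fst.mul (hcomp.clm_apply continuousOn_const))
    fun σ hσ => hω.isCurlFreeAt_cone (hmem ⟨Ioo_subset_Icc_self hσ.1, Ioo_subset_Icc_self hσ.2⟩)

theorem IsGateauxClosedOn.exists_curveIntegral_segment_add (hω : IsGateauxClosedOn ω W)
    (hW : IsOpen W) {K : Set V} (hK : IsCompact K) (hKW : K ⊆ W) :
    ∃ δ > 0, ∀ p ∈ K, ∀ x ∈ Metric.ball p δ, ∀ y ∈ Metric.ball p δ, ∀ z ∈ Metric.ball p δ,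
      (∫ᶜ a in .segment x y, ω a) + ∫ᶜ a in .segment y z, ω a =
        ∫ᶜ a in .segment x z, ω a := by
  obtain ⟨δ, hδ, hthick⟩ := hK.exists_thickening_subset_open hW hKW
  refine ⟨δ, hδ, fun p hp x hx y hy z hz => ?_⟩
  have hball : Metric.ball p δ ⊆ W := (Metric.ball_subset_thickening hp δ).trans hthick
  exact (hω.mono hball).curveIntegral_segment_add (convex_ball p δ) hx hy hz

end ClosedForms

section Partition

theorem natCast_div_mem_Icc {i n : ℕ} (hi : i ≤ n) : (i : ℝ) / n ∈ Icc (0 : ℝ) 1 :=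
  unitInterval.div_mem i.cast_nonneg n.cast_nonneg (Nat.cast_le.2 hi)

theorem dist_natCast_add_div_le {i a n : ℕ} (ha : a ≤ 1) :
    dist (((i + a : ℕ) : ℝ) / n) ((i : ℝ) / n) ≤ 1 / n := by
  have ha' : (a : ℝ) ≤ 1 := mod_cast ha
  rw [Real.dist_eq, Nat.cast_add, div_sub_div_same, add_sub_cancel_left,
    abs_of_nonneg (by positivity)]
  gcongr

theorem eventually_dist_partition_lt {E : Type*} [PseudoMetricSpace E] {c : ℝ → E}
    (hc : ContinuousOn c (Icc 0 1)) {δ : ℝ} (hδ : 0 < δ) :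
    ∀ᶠ n : ℕ in atTop, ∀ i < n, dist (c (((i + 1 : ℕ) : ℝ) / n)) (c ((i : ℝ) / n)) < δ := by
  obtain ⟨η, hη, hunif⟩ := Metric.uniformContinuousOn_iff.1
    (isCompact_Icc.uniformContinuousOn_of_continuous hc) δ hδ
  filter_upwards [tendsto_one_div_atTop_nhds_zero_nat.eventually_lt_const hη] with n hn i hi
  exact hunif _ (natCast_div_mem_Icc hi) _ (natCast_div_mem_Icc hi.le)
    ((dist_natCast_add_div_le le_rfl).trans_lt hn)

theorem eventually_dist_grid_lt {E : Type*} [PseudoMetricSpace E] {X : ℝ × ℝ → E}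
    (hX : ContinuousOn X (Icc 0 1 ×ˢ Icc 0 1)) {δ : ℝ} (hδ : 0 < δ) :
    ∀ᶠ n : ℕ in atTop, ∀ i < n, ∀ j < n, ∀ a ≤ 1, ∀ b ≤ 1,
      dist (X (((i + a : ℕ) : ℝ) / n, ((j + b : ℕ) : ℝ) / n)) (X ((i : ℝ) / n, (j : ℝ) / n)) <
        δ := by
  obtain ⟨η, hη, hunif⟩ := Metric.uniformContinuousOn_iff.1
    ((isCompact_rect 0 1 0 1).uniformContinuousOn_of_continuous hX) δ hδ
  filter_upwards [tendsto_one_div_atTop_nhds_zero_nat.eventually_lt_const hη]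
    with n hn i hi j hj a ha b hb
  exact hunif _ ⟨natCast_div_mem_Icc (by omega), natCast_div_mem_Icc (by omega)⟩ _
    ⟨natCast_div_mem_Icc hi.le, natCast_div_mem_Icc hj.le⟩
    (max_lt ((dist_natCast_add_div_le ha).trans_lt hn) ((dist_natCast_add_div_le hb).trans_lt hn))

end Partition

section Homotopy

theorem sum_range_eq_of_grid {M : Type*} [AddCommGroup M] {h v : ℕ → ℕ → M} {m n : ℕ}
    (hcell : ∀ i < m, ∀ j < n, h i j + v i (j + 1) = v i j + h (i + 1) j)
    (hper : ∀ i < m, v i 0 = v i n) :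
    ∑ j ∈ Finset.range n, h 0 j = ∑ j ∈ Finset.range n, h m j := by
  induction m with
  | zero => rfl
  | succ m ih =>
    rw [ih (fun i hi => hcell i (hi.trans m.lt_succ_self))
      (fun i hi => hper i (hi.trans m.lt_succ_self)), ← sub_eq_zero, ← Finset.sum_sub_distrib]
    have hdiff : ∀ j ∈ Finset.range n, h m j - h (m + 1) j = v m j - v m (j + 1) := fun j hj =>
      sub_eq_sub_iff_add_eq_add.2 (hcell m m.lt_succ_self j (Finset.mem_range.1 hj))
    rw [Finset.sum_congr rfl hdiff, Finset.sum_range_sub', hper m m.lt_succ_self, sub_self]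

theorem exists_map_prod_of_nullhomotopic {Y : Type*} [TopologicalSpace Y]
    {γ : C(UnitAddCircle, Y)} (hγ : γ.Nullhomotopic) :
    ∃ (X : C(ℝ × ℝ, Y)) (y : Y), (∀ t : ℝ, X (0, t) = γ t) ∧ (∀ t, X (1, t) = y) ∧
      ∀ s, X (s, 0) = X (s, 1) := by
  obtain ⟨y, ⟨H⟩⟩ := hγ
  refine ⟨⟨fun σ => H (projIcc 0 1 zero_le_one σ.1, (σ.2 : UnitAddCircle)), ?_⟩, y,
    fun t => ?_, fun t => ?_, fun s => ?_⟩
  · exact H.continuous.comp ((continuous_projIcc.comp continuous_fst).prodMk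
      ((AddCircle.continuous_mk' 1).comp continuous_snd))
  · simp
  · simp
  · simp [AddCircle.coe_period]

theorem eventually_sum_eq_zero_of_nullhomotopic {E M : Type*} [PseudoMetricSpace E]
    [AddCommGroup M] {F : E → E → M} {W : Set E}
    (hF : ∀ K ⊆ W, IsCompact K → ∃ δ > 0, ∀ p ∈ K, ∀ x ∈ Metric.ball p δ, ∀ y ∈ Metric.ball p δ,
      ∀ z ∈ Metric.ball p δ, F x y + F y z = F x z)
    {γ : C(UnitAddCircle, W)} (hγ : γ.Nullhomotopic) :
    ∀ᶠ n : ℕ in atTop, ∑ j ∈ Finset.range n,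
      F (γ ((j / n : ℝ) : UnitAddCircle)) (γ (((j + 1 : ℕ) / n : ℝ) : UnitAddCircle)) = 0 := by
  obtain ⟨X, y, hX0, hX1, hper⟩ := exists_map_prod_of_nullhomotopic hγ
  have hXc : Continuous fun σ => (X σ : E) := continuous_subtype_val.comp X.continuous
  obtain ⟨δ, hδ, hadd⟩ := hF _ (image_subset_iff.2 fun σ _ => (X σ).2)
    ((isCompact_rect 0 1 0 1).image hXc)
  filter_upwards [eventually_dist_grid_lt hXc.continuousOn hδ, eventually_ne_atTop 0]
    with n hfine hn
  have hnn : (n : ℝ) / n = 1 := div_self (Nat.cast_ne_zero.2 hn)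
  let x (i j : ℕ) : E := X ((i : ℝ) / n, (j : ℝ) / n)
  have hcell : ∀ i < n, ∀ j < n, F (x i j) (x i (j + 1)) + F (x i (j + 1)) (x (i + 1) (j + 1)) =
      F (x i j) (x (i + 1) j) + F (x (i + 1) j) (x (i + 1) (j + 1)) := by
    intro i hi j hj
    have hball (a b : ℕ) (ha : a ≤ 1) (hb : b ≤ 1) : x (i + a) (j + b) ∈ Metric.ball (x i j) δ :=
      hfine i hi j hj a ha b hb
    have htriangle := hadd (x i j) ⟨_, ⟨natCast_div_mem_Icc hi.le, natCast_div_mem_Icc hj.le⟩, rfl⟩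
      _ (hball 0 0 zero_le_one zero_le_one)
    exact (htriangle _ (hball 0 1 zero_le_one le_rfl) _ (hball 1 1 le_rfl le_rfl)).trans
      (htriangle _ (hball 1 0 le_rfl zero_le_one) _ (hball 1 1 le_rfl le_rfl)).symm
  have hself : F y y = 0 := by
    have hy := Metric.mem_ball_self (x := (y : E)) hδ
    simpa using hadd y ⟨(1, 0), by simp, congrArg Subtype.val (hX1 0)⟩ y hy y hy y hy
  simpa only [x, Nat.cast_zero, zero_div, hnn, hX0, hX1, hself, Finset.sum_const_zero] using
    sum_range_eq_of_grid (h := fun i j => F (x i j) (x i (j + 1)))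
      (v := fun i j => F (x i j) (x (i + 1) j)) hcell fun i _ => by
        simp only [x, Nat.cast_zero, zero_div, hnn, hper]

theorem IsGateauxClosedOn.eventually_sum_curveIntegral_eq_zero {V : Type*}
    [NormedAddCommGroup V] [NormedSpace ℝ V] {ω : V → V →L[ℝ] ℝ} {W : Set V}
    (hω : IsGateauxClosedOn ω W) (hW : IsOpen W) {γ : C(UnitAddCircle, W)}
    (hγ : γ.Nullhomotopic) :
    ∀ᶠ n : ℕ in atTop, ∑ j ∈ Finset.range n,
      (∫ᶜ a in .segment (γ ((j / n : ℝ) : UnitAddCircle) : V)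
        (γ (((j + 1 : ℕ) / n : ℝ) : UnitAddCircle) : V), ω a) = 0 :=
  eventually_sum_eq_zero_of_nullhomotopic
    (F := fun x y => ∫ᶜ a in .segment x y, ω a)
    (fun _ hKW hK => hω.exists_curveIntegral_segment_add hW hK hKW) hγ

end Homotopy

section RiemannStieltjes

variable {f g g' : ℝ → ℝ} {J J' : ℝ}

theorem mem_Icc_of_partition {N i : ℕ} {t : ℕ → ℝ} (h0 : t 0 = 0) (h1 : t N = 1)
    (hle : ∀ i < N, t i ≤ t (i + 1)) (hi : i ≤ N) : t i ∈ Icc (0 : ℝ) 1 := by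
  have hmono : MonotoneOn t (Icc 0 N) :=
    monotoneOn_of_le_add_one ordConnected_Icc fun j _ _ hj => hle j hj.2
  rw [← h0, ← h1]
  exact ⟨hmono ⟨le_rfl, N.zero_le⟩ ⟨i.zero_le, hi⟩ i.zero_le,
    hmono ⟨i.zero_le, hi⟩ ⟨N.zero_le, le_rfl⟩ hi⟩

theorem HasStieltjesIntegral.congr_right (h : HasStieltjesIntegral f g J)
    (hg : EqOn g g' (Icc 0 1)) : HasStieltjesIntegral f g' J := by
  intro ε hε
  obtain ⟨δ, hδ, H⟩ := h ε hε
  refine ⟨δ, hδ, fun N t ξ h0 h1 hp => ?_⟩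
  have hmem : ∀ i ≤ N, t i ∈ Icc (0 : ℝ) 1 := fun i =>
    mem_Icc_of_partition h0 h1 fun j hj => (hp j hj).1.1.trans (hp j hj).1.2
  convert H N t ξ h0 h1 hp using 3
  refine Finset.sum_congr rfl fun i hi => ?_
  have hi := Finset.mem_range.1 hi
  rw [hg (hmem i hi.le), hg (hmem (i + 1) hi)]

theorem HasStieltjesIntegral.sub_right (h : HasStieltjesIntegral f g J)
    (h' : HasStieltjesIntegral f g' J') : HasStieltjesIntegral f (g - g') (J - J') := by
  intro ε hε
  obtain ⟨δ, hδ, H⟩ := h (ε / 2) (half_pos hε)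
  obtain ⟨δ', hδ', H'⟩ := h' (ε / 2) (half_pos hε)
  refine ⟨min δ δ', lt_min hδ hδ', fun N t ξ h0 h1 hp => ?_⟩
  have hsub : ∑ i ∈ Finset.range N, f (ξ i) * ((g - g') (t (i + 1)) - (g - g') (t i)) =
      ∑ i ∈ Finset.range N, f (ξ i) * (g (t (i + 1)) - g (t i)) -
        ∑ i ∈ Finset.range N, f (ξ i) * (g' (t (i + 1)) - g' (t i)) := by
    rw [← Finset.sum_sub_distrib]
    refine Finset.sum_congr rfl fun i _ => ?_
    simp only [Pi.sub_apply]
    ring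
  rw [hsub, sub_sub_sub_comm]
  refine (abs_sub _ _).trans_lt ((add_lt_add
    (H N t ξ h0 h1 fun i hi => ⟨(hp i hi).1, (hp i hi).2.trans_le (min_le_left _ _)⟩)
    (H' N t ξ h0 h1 fun i hi => ⟨(hp i hi).1, (hp i hi).2.trans_le (min_le_right _ _)⟩)).trans_eq
    (add_halves ε))

theorem HasStieltjesIntegral.tendsto_uniform_sum (h : HasStieltjesIntegral f g J) :
    Tendsto (fun n : ℕ => ∑ i ∈ Finset.range n,
      f ((i : ℝ) / n) * (g (((i + 1 : ℕ) : ℝ) / n) - g ((i : ℝ) / n))) atTop (𝓝 J) := by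
  rw [Metric.tendsto_nhds]
  intro ε hε
  obtain ⟨δ, hδ, H⟩ := h ε hε
  filter_upwards [tendsto_one_div_atTop_nhds_zero_nat.eventually_lt_const hδ,
    eventually_ne_atTop 0] with n hn hn0
  refine H n (fun i => (i : ℝ) / n) (fun i => (i : ℝ) / n) (by simp)
    (div_self (Nat.cast_ne_zero.2 hn0)) fun i _ => ⟨⟨le_rfl, ?_⟩, ?_⟩
  · gcongr
    exact i.le_succ
  · exact (le_abs_self _).trans_lt ((dist_natCast_add_div_le le_rfl).trans_lt hn)

theorem abs_mul_sub_intervalIntegral_stieltjesFunction_le {p : StieltjesFunction ℝ}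
    {a b c ε : ℝ} (hab : a ≤ b) (hf : IntervalIntegrable f p.measure a b)
    (hfc : ∀ x ∈ Ioc a b, |c - f x| ≤ ε) :
    |c * (p b - p a) - ∫ x in a..b, f x ∂p.measure| ≤ ε * (p b - p a) := by
  have hvol : p.measure.real (Ioc a b) = p b - p a := by
    rw [measureReal_def, p.measure_Ioc, ENNReal.toReal_ofReal (sub_nonneg.2 (p.mono hab))]
  have hconst : ∫ _ in a..b, c ∂p.measure = c * (p b - p a) := by
    rw [intervalIntegral.integral_of_le hab, setIntegral_const, hvol, smul_eq_mul, mul_comm]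
  rw [← hconst, ← intervalIntegral.integral_sub intervalIntegrable_const hf,
    intervalIntegral.integral_of_le hab, ← hvol]
  exact norm_setIntegral_le_of_norm_le_const (f := fun x => c - f x) measure_Ioc_lt_top hfc

theorem hasStieltjesIntegral_stieltjesFunction (hf : ContinuousOn f (Icc 0 1))
    (p : StieltjesFunction ℝ) : HasStieltjesIntegral f p (∫ x in (0 : ℝ)..1, f x ∂p.measure) := by
  intro ε hε
  obtain ⟨ε', hε', hlt⟩ := exists_pos_mul_lt hε (p 1 - p 0)
  obtain ⟨δ, hδ, hunif⟩ := Metric.uniformContinuousOn_iff.1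
    (isCompact_Icc.uniformContinuousOn_of_continuous hf) ε' hε'
  refine ⟨δ, hδ, fun N t ξ h0 h1 hpart => ?_⟩
  have hle : ∀ i < N, t i ≤ t (i + 1) := fun i hi => (hpart i hi).1.1.trans (hpart i hi).1.2
  have hsub : ∀ i < N, Icc (t i) (t (i + 1)) ⊆ Icc 0 1 := fun i hi =>
    Icc_subset_Icc (mem_Icc_of_partition h0 h1 hle hi.le).1 (mem_Icc_of_partition h0 h1 hle hi).2
  have hint : ∀ i < N, IntervalIntegrable f p.measure (t i) (t (i + 1)) := fun i hi =>
    (hf.mono (by rw [uIcc_of_le (hle i hi)]; exact hsub i hi)).intervalIntegrable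
  have hterm : ∀ i ∈ Finset.range N,
      |f (ξ i) * (p (t (i + 1)) - p (t i)) - ∫ x in (t i)..(t (i + 1)), f x ∂p.measure| ≤
        ε' * (p (t (i + 1)) - p (t i)) := by
    intro i hi
    have hi := Finset.mem_range.1 hi
    obtain ⟨hξ, hmesh⟩ := hpart i hi
    refine abs_mul_sub_intervalIntegral_stieltjesFunction_le (hle i hi) (hint i hi) fun x hx => ?_
    have hx := Ioc_subset_Icc_self hx
    exact (hunif _ (hsub i hi hξ) x (hsub i hi hx)
      ((Real.dist_le_of_mem_Icc hξ hx).trans_lt hmesh)).le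
  rw [← h0, ← h1, ← intervalIntegral.sum_integral_adjacent_intervals hint,
    ← Finset.sum_sub_distrib]
  calc _ ≤ ∑ i ∈ Finset.range N, ε' * (p (t (i + 1)) - p (t i)) :=
        (Finset.abs_sum_le_sum_abs _ _).trans (Finset.sum_le_sum hterm)
    _ = (p 1 - p 0) * ε' := by
        rw [← Finset.mul_sum, Finset.sum_range_sub (fun i => p (t i)), h0, h1, mul_comm]
    _ < ε := hlt

theorem exists_hasStieltjesIntegral (hf : ContinuousOn f (Icc 0 1))
    (hg : ContinuousOn g (Icc 0 1)) (hbv : BoundedVariationOn g (Icc 0 1)) :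
    ∃ J, HasStieltjesIntegral f g J := by
  set G : ℝ → ℝ := fun t => g (projIcc 0 1 zero_le_one t) with hG
  have hGg : EqOn G g (Icc 0 1) := fun t ht => by simp only [hG, projIcc_of_mem zero_le_one ht]
  have hGc : Continuous G := (continuousOn_iff_continuous_domRestrict.1 hg).comp continuous_projIcc
  have hGbv : BoundedVariationOn G univ :=
    ne_top_of_le_ne_top hbv (eVariationOn.comp_le_of_monotoneOn g
      (fun t : ℝ => (projIcc 0 1 zero_le_one t : ℝ))
      ((Subtype.mono_coe _).comp (monotone_projIcc zero_le_one) |>.monotoneOn _)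
      fun t _ => Subtype.coe_prop _)
  have hloc := hGbv.locallyBoundedVariationOn
  have hvc (x : ℝ) : ContinuousWithinAt (variationOnFromTo G univ 0) (Ici x) x :=
    hGbv.continuousWithinAt_variationOnFromTo_Ici hGc.continuousWithinAt
  let p : StieltjesFunction ℝ := ⟨variationOnFromTo G univ 0,
    monotoneOn_univ.1 (variationOnFromTo.monotoneOn hloc (mem_univ 0)), hvc⟩
  let q : StieltjesFunction ℝ := ⟨variationOnFromTo G univ 0 - G,
    monotoneOn_univ.1 (variationOnFromTo.sub_self_monotoneOn hloc (mem_univ 0)),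
    fun x => (hvc x).sub hGc.continuousWithinAt⟩
  refine ⟨_, ((hasStieltjesIntegral_stieltjesFunction hf p).sub_right
    (hasStieltjesIntegral_stieltjesFunction hf q)).congr_right fun t ht => ?_⟩
  simp only [p, q, Pi.sub_apply, sub_sub_cancel, hGg ht]

end RiemannStieltjes

section InscribedPolygons

theorem sum_dist_le_eVariationOn {E : Type*} [PseudoMetricSpace E] {c : ℝ → E}
    (hbv : BoundedVariationOn c (Icc 0 1)) (n : ℕ) :
    ∑ i ∈ Finset.range n, dist (c (((i + 1 : ℕ) : ℝ) / n)) (c ((i : ℝ) / n)) ≤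
      (eVariationOn c (Icc 0 1)).toReal := by
  simp only [dist_edist]
  rw [← ENNReal.toReal_sum fun i _ => edist_ne_top _ _]
  refine ENNReal.toReal_mono hbv (eVariationOn.sum_le_of_monotoneOn_Iic
    (u := fun i : ℕ => (i : ℝ) / n) (Monotone.monotoneOn (fun i j hij => ?_) _)
    fun i hi => natCast_div_mem_Icc hi)
  gcongr

variable {V : Type*} [NormedAddCommGroup V] [NormedSpace ℝ V] {ω : V → V →L[ℝ] ℝ} {W : Set V}

theorem abs_sub_curveIntegral_segment_le {ε : ℝ} {x y : V}
    (hω : ContinuousOn ω (segment ℝ x y)) (h : ∀ a ∈ segment ℝ x y, ‖ω x - ω a‖ ≤ ε) :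
    |ω x (y - x) - ∫ᶜ a in .segment x y, ω a| ≤ ε * ‖y - x‖ := by
  rw [← curveIntegral_segment_const, ← curveIntegral_fun_sub
    (curveIntegrable_segment_of_continuousOn continuousOn_const Subset.rfl)
    (curveIntegrable_segment_of_continuousOn hω Subset.rfl)]
  exact norm_curveIntegral_segment_le h

theorem exists_abs_sub_curveIntegral_segment_le (hW : IsOpen W) (hω : ContinuousOn ω W)
    {K : Set V} (hK : IsCompact K) (hKW : K ⊆ W) {ε : ℝ} (hε : 0 < ε) :
    ∃ ρ > 0, ∀ x ∈ K, ∀ y ∈ Metric.ball x ρ,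
      |ω x (y - x) - ∫ᶜ a in .segment x y, ω a| ≤ ε * ‖y - x‖ := by
  obtain ⟨ρ₁, hρ₁, hunif⟩ := Metric.mem_uniformity_dist.1
    (hK.uniformContinuousAt_of_continuousAt ω
      (fun a ha => hω.continuousAt (hW.mem_nhds (hKW ha))) (Metric.dist_mem_uniformity hε))
  obtain ⟨ρ₂, hρ₂, hthick⟩ := hK.exists_thickening_subset_open hW hKW
  refine ⟨min ρ₁ ρ₂, lt_min hρ₁ hρ₂, fun x hx y hy => ?_⟩
  have hseg : segment ℝ x y ⊆ Metric.ball x (min ρ₁ ρ₂) :=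
    (convex_ball x _).segment_subset (Metric.mem_ball_self (lt_min hρ₁ hρ₂)) hy
  refine abs_sub_curveIntegral_segment_le (hω.mono fun a ha => hthick ?_) fun a ha => ?_
  · exact Metric.ball_subset_thickening hx ρ₂
      (Metric.ball_subset_ball (min_le_right _ _) (hseg ha))
  · rw [← dist_eq_norm]
    exact (hunif ((Metric.mem_ball'.1 (hseg ha)).trans_le (min_le_left _ _)) hx).le

theorem tendsto_sum_sub_curveIntegral_segment (hW : IsOpen W) (hω : ContinuousOn ω W)
    {c : ℝ → V} (hc : ContinuousOn c (Icc 0 1)) (hcW : MapsTo c (Icc 0 1) W)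
    (hbv : BoundedVariationOn c (Icc 0 1)) :
    Tendsto (fun n : ℕ => ∑ i ∈ Finset.range n,
      (ω (c ((i : ℝ) / n)) (c (((i + 1 : ℕ) : ℝ) / n) - c ((i : ℝ) / n)) -
        ∫ᶜ a in .segment (c ((i : ℝ) / n)) (c (((i + 1 : ℕ) : ℝ) / n)), ω a)) atTop (𝓝 0) := by
  rw [Metric.tendsto_nhds]
  intro ε hε
  obtain ⟨ε', hε', hlt⟩ := exists_pos_mul_lt hε (eVariationOn c (Icc 0 1)).toReal
  obtain ⟨ρ, hρ, hterm⟩ := exists_abs_sub_curveIntegral_segment_le hW hω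
    (isCompact_Icc.image_of_continuousOn hc) hcW.image_subset hε'
  filter_upwards [eventually_dist_partition_lt hc hρ] with n hfine
  rw [dist_zero_right]
  calc _ ≤ ∑ i ∈ Finset.range n, ε' * dist (c (((i + 1 : ℕ) : ℝ) / n)) (c ((i : ℝ) / n)) := by
        refine (norm_sum_le _ _).trans (Finset.sum_le_sum fun i hi => ?_)
        have hi := Finset.mem_range.1 hi
        rw [dist_eq_norm]
        exact hterm _ (mem_image_of_mem c (natCast_div_mem_Icc hi.le)) _ (hfine i hi)
    _ ≤ ε' * (eVariationOn c (Icc 0 1)).toReal := by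
        rw [← Finset.mul_sum]
        gcongr
        exact sum_dist_le_eVariationOn hbv n
    _ < ε := by rwa [mul_comm]

theorem IsGateauxClosedOn.tendsto_sum_zero (hω : IsGateauxClosedOn ω W) (hW : IsOpen W)
    {γ : C(UnitAddCircle, W)} (hγ : γ.Nullhomotopic)
    (hbv : BoundedVariationOn (fun t : ℝ => (γ (t : UnitAddCircle) : V)) (Icc 0 1)) :
    Tendsto (fun n : ℕ => ∑ i ∈ Finset.range n,
      ω (γ (((i : ℝ) / n : ℝ) : UnitAddCircle) : V)
        ((γ ((((i + 1 : ℕ) : ℝ) / n : ℝ) : UnitAddCircle) : V) -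
          (γ (((i : ℝ) / n : ℝ) : UnitAddCircle) : V))) atTop (𝓝 0) := by
  have hc : Continuous fun t : ℝ => (γ (t : UnitAddCircle) : V) :=
    continuous_subtype_val.comp (γ.continuous.comp (AddCircle.continuous_mk' 1))
  refine (tendsto_sum_sub_curveIntegral_segment hW hω.continuousOn hc.continuousOn
    (fun _ _ => Subtype.coe_prop _) hbv).congr' ?_
  filter_upwards [hω.eventually_sum_curveIntegral_eq_zero hW hγ] with n hn
  rw [Finset.sum_sub_distrib, hn, sub_zero]

end InscribedPolygons

section ScalarForm

theorem hasLineDerivAt_of_tendsto_right {E F : Type*} [AddCommGroup E] [Module ℝ E]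
    [NormedAddCommGroup F] [NormedSpace ℝ F] {f : E → F} {f' : F} {x v : E}
    (hr : Tendsto (fun ε : ℝ => ε⁻¹ • (f (x + ε • v) - f x)) (𝓝[>] 0) (𝓝 f'))
    (hl : Tendsto (fun ε : ℝ => ε⁻¹ • (f (x + ε • -v) - f x)) (𝓝[>] 0) (𝓝 (-f'))) :
    HasLineDerivAt ℝ f f' x v := by
  rw [hasLineDerivAt_iff_tendsto_slope_zero, ← nhdsLT_sup_nhdsGT, tendsto_sup]
  refine ⟨?_, hr⟩
  have hneg : Tendsto (fun t : ℝ => -t) (𝓝[<] 0) (𝓝[>] 0) := by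
    simpa only [neg_zero] using tendsto_neg_nhdsLT (a := (0 : ℝ))
  simpa only [Function.comp_def, smul_neg, neg_smul, neg_neg, inv_neg] using (hl.comp hneg).neg

variable {A : Type*} [CommRing A] [Algebra ℂ A] {k : ℕ} {e : Fin k → A} {Φ : A → A} {Ω : Set A}

theorem isLinearMap_point (e : Fin k → A) : IsLinearMap ℝ (point e) where
  map_add x y := by simp only [point, PiLp.add_apply, add_smul, Finset.sum_add_distrib]
  map_smul c x := by simp only [point, PiLp.smul_apply, smul_assoc, Finset.smul_sum]

theorem point_mem_realSpan (e : Fin k → A) (x : EuclideanSpace ℝ (Fin k)) :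
    point e x ∈ realSpan e :=
  Submodule.sum_mem _ fun j _ => Submodule.smul_mem _ _ (Submodule.subset_span (mem_range_self j))

/-- The real-valued 1-form `ℓ(Φ(ζ) dζ)` obtained from the algebra-valued form `Φ(ζ) dζ` by a real
functional `ℓ`, in the coordinates `x ∈ ℝ^k` of `ζ = ∑ⱼ xⱼ eⱼ`. -/
def scalarForm (e : Fin k → A) (Φ : A → A) (ℓ : A →ₗ[ℝ] ℝ) (x : EuclideanSpace ℝ (Fin k)) :
    EuclideanSpace ℝ (Fin k) →L[ℝ] ℝ :=
  LinearMap.toContinuousLinearMap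
    (ℓ ∘ₗ LinearMap.mulRight ℝ (Φ (point e x)) ∘ₗ (isLinearMap_point e).mk' (point e))

theorem scalarForm_apply (e : Fin k → A) (Φ : A → A) (ℓ : A →ₗ[ℝ] ℝ)
    (x h : EuclideanSpace ℝ (Fin k)) :
    scalarForm e Φ ℓ x h = ℓ (point e h * Φ (point e x)) :=
  rfl

variable [TopologicalSpace A] [IsTopologicalAddGroup A] [ContinuousSMul ℂ A]

theorem continuous_map_mul_left [T2Space A] [Module.Finite ℂ A] (ℓ : A →ₗ[ℝ] ℝ) (a : A) :
    Continuous fun b => ℓ (a * b) := by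
  have : Module.Finite ℝ A := .trans ℂ A
  have : ContinuousSMul ℝ A := IsScalarTower.continuousSMul ℂ
  exact (ℓ ∘ₗ LinearMap.mulLeft ℝ a).continuous_of_finiteDimensional

theorem IsMonogenicOn.exists_hasLineDerivAt_scalarForm [T2Space A] [Module.Finite ℂ A]
    (hΦ : IsMonogenicOn e Φ Ω) (ℓ : A →ₗ[ℝ] ℝ) {x : EuclideanSpace ℝ (Fin k)}
    (hx : x ∈ realSet e Ω) :
    ∃ d : A, ∀ h h', HasLineDerivAt ℝ (fun y => scalarForm e Φ ℓ y h')
      (ℓ (point e h' * (point e h * d))) x h := by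
  obtain ⟨d, hd⟩ := hΦ.gateaux _ hx
  have hright (h h' : EuclideanSpace ℝ (Fin k)) : Tendsto (fun ε : ℝ =>
      ε⁻¹ • (scalarForm e Φ ℓ (x + ε • h) h' - scalarForm e Φ ℓ x h')) (𝓝[>] 0)
      (𝓝 (ℓ (point e h' * (point e h * d)))) := by
    refine (((continuous_map_mul_left ℓ (point e h')).tendsto _).comp
      (hd _ (point_mem_realSpan e h))).congr fun ε => ?_
    simp only [Function.comp_apply, scalarForm_apply, (isLinearMap_point e).map_add,
      (isLinearMap_point e).map_smul, mul_smul_comm, mul_sub, map_smul, map_sub]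
  refine ⟨d, fun h h' => hasLineDerivAt_of_tendsto_right (hright h h') ?_⟩
  simpa only [(isLinearMap_point e).map_neg, neg_mul, mul_neg, map_neg] using hright (-h) h'

theorem IsMonogenicOn.isGateauxClosedOn [T2Space A] [Module.Finite ℂ A]
    (hΦ : IsMonogenicOn e Φ Ω) (ℓ : A →ₗ[ℝ] ℝ) :
    IsGateauxClosedOn (scalarForm e Φ ℓ) (realSet e Ω) := by
  refine ⟨continuousOn_clm_apply.2 fun h =>
    (continuous_map_mul_left ℓ (point e h)).comp_continuousOn hΦ.continuousOn, fun x hx => ?_⟩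
  obtain ⟨d, hd⟩ := hΦ.exists_hasLineDerivAt_scalarForm ℓ hx
  let pointₗ := (isLinearMap_point e).mk' (point e)
  exact ⟨((LinearMap.mul ℝ A).compr₂ (ℓ ∘ₗ LinearMap.mulRight ℝ d)).compl₁₂ pointₗ pointₗ,
    fun h h' => congrArg (fun a => ℓ (a * d)) (mul_comm _ _),
    fun h h' => (hd h h').congr_deriv (congrArg ℓ (by
      rw [mul_left_comm, ← mul_assoc]
      rfl))⟩

end ScalarForm

section CurveIntegral

variable {A : Type*} [CommRing A] [Algebra ℂ A] {n k : ℕ} {I : Module.Basis (Fin n) ℂ A}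
  {e : Fin k → A} {Ψ : A → A} {x : ℝ → EuclideanSpace ℝ (Fin k)}

theorem point_mul_eq_sum (I : Module.Basis (Fin n) ℂ A) (e : Fin k → A)
    (h : EuclideanSpace ℝ (Fin k)) (a : A) :
    point e h * a = (∑ j, e j * ∑ r, ((I.repr a r).re * h j) • I r) +
      Complex.I • ∑ j, e j * ∑ r, ((I.repr a r).im * h j) • I r := by
  have hcoord (r : Fin n) : I.repr a r • I r =
      (I.repr a r).re • I r + Complex.I • (I.repr a r).im • I r := by
    conv_lhs => rw [← Complex.re_add_im (I.repr a r), add_smul, mul_comm, mul_smul]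
    simp only [Complex.coe_smul]
  conv_lhs => rw [← I.sum_repr a, point, Finset.sum_mul]
  rw [Finset.smul_sum, ← Finset.sum_add_distrib]
  refine Finset.sum_congr rfl fun j _ => ?_
  simp only [hcoord, Finset.sum_add_distrib, Finset.mul_sum, Finset.smul_sum, mul_add,
    smul_mul_assoc, mul_smul_comm, mul_smul, smul_comm Complex.I]

variable [TopologicalSpace A] [IsTopologicalAddGroup A] [ContinuousSMul ℂ A]

theorem exists_hasCurveIntegral [T2Space A] (I : Module.Basis (Fin n) ℂ A)
    (hΨ : ContinuousOn (fun t => Ψ (point e (x t))) (Icc 0 1)) (hx : ContinuousOn x (Icc 0 1))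
    (hbv : BoundedVariationOn x (Icc 0 1)) : ∃ z, HasCurveIntegral I e Ψ x z := by
  have : Module.Finite ℂ A := .of_basis I
  have hrepr (r : Fin n) : ContinuousOn (fun t => I.repr (Ψ (point e (x t))) r) (Icc 0 1) :=
    (I.coord r).continuous_of_finiteDimensional.comp_continuousOn hΨ
  have hxj (j : Fin k) : ContinuousOn (fun t => x t j) (Icc 0 1) := by fun_prop
  have hbvj (j : Fin k) : BoundedVariationOn (fun t => x t j) (Icc 0 1) :=
    (EuclideanSpace.proj j : EuclideanSpace ℝ (Fin k) →L[ℝ] ℝ).lipschitz.comp_boundedVariationOn hbv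
  choose P hP using fun j r => exists_hasStieltjesIntegral
    (Complex.continuous_re.comp_continuousOn (hrepr r)) (hxj j) (hbvj j)
  choose Q hQ using fun j r => exists_hasStieltjesIntegral
    (Complex.continuous_im.comp_continuousOn (hrepr r)) (hxj j) (hbvj j)
  exact ⟨_, P, Q, hP, hQ, rfl⟩

theorem HasCurveIntegral.tendsto_sum {z : A} (h : HasCurveIntegral I e Ψ x z) :
    Tendsto (fun N : ℕ => ∑ i ∈ Finset.range N,
      point e (x (((i + 1 : ℕ) : ℝ) / N) - x ((i : ℝ) / N)) * Ψ (point e (x ((i : ℝ) / N))))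
      atTop (𝓝 z) := by
  obtain ⟨P, Q, hP, hQ, rfl⟩ := h
  have : ContinuousSMul ℝ A := IsScalarTower.continuousSMul ℂ
  have hlim {g : Fin k → Fin n → ℕ → ℝ} {R : Fin k → Fin n → ℝ}
      (hg : ∀ j r, Tendsto (g j r) atTop (𝓝 (R j r))) :
      Tendsto (fun N => ∑ j, e j * ∑ r, g j r N • I r) atTop (𝓝 (∑ j, e j * ∑ r, R j r • I r)) := by
    simp only [Finset.mul_sum, mul_smul_comm]
    exact tendsto_finsetSum _ fun j _ => tendsto_finsetSum _ fun r _ => (hg j r).smul_const _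
  refine ((hlim fun j r => (hP j r).tendsto_uniform_sum).add
    ((hlim fun j r => (hQ j r).tendsto_uniform_sum).const_smul Complex.I)).congr fun N => ?_
  simp only [point_mul_eq_sum I, Finset.sum_add_distrib, Finset.sum_smul, Finset.mul_sum,
    Finset.smul_sum, PiLp.sub_apply]
  congr 1 <;> exact (Finset.sum_congr rfl fun j _ => Finset.sum_comm).trans Finset.sum_comm

end CurveIntegral

end Monogenic

end

theorem theorem2_general {A : Type*} [CommRing A] [Algebra ℂ A]
    [TopologicalSpace A] [IsTopologicalAddGroup A] [ContinuousSMul ℂ A] [T2Space A]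
    {n k : ℕ} (I : Module.Basis (Fin n) ℂ A) (e : Fin k → A)
    (Ω : Set A) (hΩ : IsOpen (Monogenic.realSet e Ω))
    (Φ : A → A) (hΦ : Monogenic.IsMonogenicOn e Φ Ω)
    (γ : C(UnitAddCircle, Monogenic.realSet e Ω))
    (hγ_rect : BoundedVariationOn
      (fun t : ℝ => (γ (t : UnitAddCircle) : EuclideanSpace ℝ (Fin k))) (Icc 0 1))
    (hγ_null : γ.Nullhomotopic) :
    Monogenic.HasCurveIntegral I e Φ
      (fun t : ℝ => (γ (t : UnitAddCircle) : EuclideanSpace ℝ (Fin k))) 0 := by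
  have : Module.Finite ℂ A := .of_basis I
  have : Module.Finite ℝ A := .trans ℂ A
  have : ContinuousSMul ℝ A := IsScalarTower.continuousSMul ℂ
  have hγ : Continuous fun t : ℝ => (γ (t : UnitAddCircle) : EuclideanSpace ℝ (Fin k)) :=
    continuous_subtype_val.comp (γ.continuous.comp (AddCircle.continuous_mk' 1))
  have hΦγ := hΦ.continuousOn.comp_continuous hγ fun t => (γ t).2
  obtain ⟨z, hz⟩ := Monogenic.exists_hasCurveIntegral I hΦγ.continuousOn hγ.continuousOn hγ_rect
  suffices z = 0 by rwa [this] at hz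
  refine (Module.forall_dual_apply_eq_zero_iff ℝ z).1 fun ℓ => ?_
  have hℓ := ((ℓ.continuous_of_finiteDimensional).tendsto z).comp hz.tendsto_sum
  refine tendsto_nhds_unique hℓ
    (((hΦ.isGateauxClosedOn ℓ).tendsto_sum_zero hΩ hγ_null hγ_rect).congr fun N => ?_)
  simp only [Function.comp_apply, map_sum, Monogenic.scalarForm_apply]

theorem theorem2 {A : Type*} [CommRing A] [Algebra ℂ A]
    -- the topology of the finite-dimensional complex vector space `A`
    [TopologicalSpace A] [IsTopologicalAddGroup A] [ContinuousSMul ℂ A] [T2Space A]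
    {n k : ℕ} (I : Module.Basis (Fin n) ℂ A)
    (hk : 2 ≤ k) (e : Fin k → A) (he_one : e ⟨0, by omega⟩ = 1)
    (he : LinearIndependent ℝ e)
    -- every multiplicative functional of `A` maps `E_k` onto `ℂ`
    (hf : ∀ f : A →ₐ[ℂ] ℂ, f '' (Monogenic.realSpan e : Set A) = univ)
    (Ω : Set A) (hΩ : Monogenic.IsDomainIn e Ω)
    (Φ : A → A) (hΦ : Monogenic.IsMonogenicOn e Φ Ω)
    -- a closed Jordan rectifiable curve in `Ω`, given in coordinates, homotopic to a point in `Ω`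
    (γ : C(UnitAddCircle, Monogenic.realSet e Ω)) (hγ_jordan : Function.Injective γ)
    (hγ_rect : BoundedVariationOn
      (fun t : ℝ => (γ (t : UnitAddCircle) : EuclideanSpace ℝ (Fin k))) (Icc 0 1))
    (hγ_null : γ.Nullhomotopic) :
    Monogenic.HasCurveIntegral I e Φ
      (fun t : ℝ => (γ (t : UnitAddCircle) : EuclideanSpace ℝ (Fin k))) 0 :=
  theorem2_general I e Ω hΩ.isOpen Φ hΦ γ hγ_rect hγ_null
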